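/- Let $n\ge 1$ and let $g=(g_{i\bar j})$ be a smooth $U(n)$-invariant Kähler metric on $\mathbb C^n$ with bounded curvature, generated by a smooth function $\xi:[0,\infty)\to\mathbb R$ with $\xi(0)=0$; that is, for some constant $c>0$, with $r=|z|^2$, $$g_{i\bar j}(z)=f(r)\,\delta_{ij}+f'(r)\,\overline{z_i}\,z_j,\qquad h(r)=c\,\exp\Bigl(-\int_0^r\frac{\xi(s)}{s}\,ds\Bigr),\qquad f(r)=\frac1r\int_0^r h(s)\,ds,\quad f(0)=h(0)=c.$$ Suppose that $\xi$ satisfies one of the following two conditions. (c1) There exist $0\le\alpha\le\beta<1$ and $\gamma\in\mathbb R$ such that for all $0<a<r$ $$\int_a^r\frac{\alpha-\xi(s)}{s}\,ds\le\gamma\quad\text{and}\quad\int_a^r\frac{\xi(s)-\beta}{s}\,ds\le\gamma .$$ (c2) $\lim_{r\to\infty}\xi(r)=1$, $\ \int_1^\infty\frac{1-\xi(s)}{s}\,ds=\infty$ (as an improper integral), and there exists $\delta>0$ such that for all $0<a<r$ $$\int_a^r\frac{1-\xi(s)}{s}\,ds\ge-\delta .$$ Then there is a constant $K$ such that for every $\epsilon>0$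 there exist a smooth $U(n)$-invariant Kähler metric $\widetilde g$ on $\mathbb C^n$ and a constant $C>0$ (which may depend on $\epsilon$) satisfying: (a) the curvature of $\widetilde g$ is bounded by $K$, that is, $|\widetilde R(X,\bar Y,Z,\bar W)|\le K\,|X|_{\widetilde g}|Y|_{\widetilde g}|Z|_{\widetilde g}|W|_{\widetilde g}$ for all $(1,0)$-vectors $X,Y,Z,W$ at every point; (b) $\frac1\epsilon\,\widetilde g\le g\le C\,\widetilde g$ on $\mathbb C^n$. -/

import Mathlib

open scoped ContDiff ComplexConjugate

noncomputable section

namespace UnKahler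

/-- The Wirtinger derivative `∂F/∂z_k` of a (real-differentiable) function on `ℂⁿ`. -/
def dz {n : ℕ} (k : Fin n) (F : (Fin n → ℂ) → ℂ) (z : Fin n → ℂ) : ℂ :=
  (1 / 2) * (fderiv ℝ F z (Pi.single k 1) - Complex.I * fderiv ℝ F z (Pi.single k Complex.I))

/-- The Wirtinger derivative `∂F/∂z̄_k`. -/
def dzbar {n : ℕ} (k : Fin n) (F : (Fin n → ℂ) → ℂ) (z : Fin n → ℂ) : ℂ :=
  (1 / 2) * (fderiv ℝ F z (Pi.single k 1) + Complex.I * fderiv ℝ F z (Pi.single k Complex.I))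

/-- `|z|²` for `z ∈ ℂⁿ`. -/
def sqNorm {n : ℕ} (z : Fin n → ℂ) : ℝ := ∑ i, Complex.normSq (z i)

/-- A field of matrices `g z i j = g_{i j̄}(z)` on `ℂⁿ`, in the standard coordinates, as a
sesquilinear form on `(1,0)`-vectors: `g(X, Ȳ) = ∑ g_{i j̄} X_i conj(Y_j)`. -/
def herm {n : ℕ} (g : (Fin n → ℂ) → Matrix (Fin n) (Fin n) ℂ) (z X Y : Fin n → ℂ) : ℂ :=
  ∑ i, ∑ j, g z i j * X i * conj (Y j)

/-- The squared length `g(X, X̄)` (a real number, as `g` is Hermitian). -/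
def quad {n : ℕ} (g : (Fin n → ℂ) → Matrix (Fin n) (Fin n) ℂ) (z X : Fin n → ℂ) : ℝ :=
  (herm g z X X).re

/-- Smooth Kähler metrics on `ℂⁿ`, given by their components in the standard coordinates. -/
structure IsKahlerMetric {n : ℕ} (g : (Fin n → ℂ) → Matrix (Fin n) (Fin n) ℂ) : Prop where
  smooth : ∀ i j, ContDiff ℝ ∞ (fun z => g z i j)
  hermitian : ∀ z, (g z).IsHermitian
  pos : ∀ z X, X ≠ 0 → 0 < quad g z X
  closed : ∀ z i j k, dz k (fun w => g w i j) z = dz i (fun w => g w k j) z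

/-- `g` is invariant under the action of the unitary group `U(n)` on `ℂⁿ`. -/
def IsUnitaryInvariant {n : ℕ} (g : (Fin n → ℂ) → Matrix (Fin n) (Fin n) ℂ) : Prop :=
  ∀ U ∈ Matrix.unitaryGroup (Fin n) ℂ, ∀ z X Y : Fin n → ℂ,
    herm g (U.mulVec z) (U.mulVec X) (U.mulVec Y) = herm g z X Y

/-- The components of the curvature tensor of a Kähler metric,
`R_{i j̄ k l̄} = -∂_k ∂_l̄ g_{i j̄} + ∑ g^{p q̄} ∂_k g_{i q̄} ∂_l̄ g_{p j̄}`,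
where `g^{p q̄}` is the `(q, p)` entry of the inverse matrix of `(g_{i j̄})`. -/
def curv {n : ℕ} (g : (Fin n → ℂ) → Matrix (Fin n) (Fin n) ℂ) (z : Fin n → ℂ)
    (i j k l : Fin n) : ℂ :=
  -dz k (dzbar l (fun w => g w i j)) z
    + ∑ p, ∑ q, (g z)⁻¹ q p * dz k (fun w => g w i q) z * dzbar l (fun w => g w p j) z

/-- The curvature tensor of `g` is bounded by `K`, in the norm of 4-linear forms given by `g`:
`|R(X, Ȳ, Z, W̄)| ≤ K |X| |Y| |Z| |W|` at every point. -/
def CurvBoundedBy {n : ℕ} (g : (Fin n → ℂ) → Matrix (Fin n) (Fin n) ℂ) (K : ℝ) : Prop :=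
  ∀ z X Y Z W : Fin n → ℂ,
    ‖∑ i, ∑ j, ∑ k, ∑ l, curv g z i j k l * X i * conj (Y j) * Z k * conj (W l)‖
      ≤ K * (√(quad g z X) * √(quad g z Y) * √(quad g z Z) * √(quad g z W))

/-- `h_ξ(r) = c exp(-∫₀ʳ ξ(s)/s ds)`, so that `h_ξ(0) = c`. -/
def hGen (ξ : ℝ → ℝ) (c r : ℝ) : ℝ := c * Real.exp (∫ s in (0 : ℝ)..r, -(ξ s / s))

/-- `f_ξ(r) = (1/r) ∫₀ʳ h_ξ(s) ds`, with `f_ξ(0) = h_ξ(0) = c`. -/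
def fGen (ξ : ℝ → ℝ) (c r : ℝ) : ℝ :=
  if r = 0 then c else (1 / r) * ∫ s in (0 : ℝ)..r, hGen ξ c s

/-- `g` is generated by the smooth function `ξ : [0, ∞) → ℝ`, `ξ(0) = 0`: for some `c > 0`,
`g_{i j̄} = f_ξ(r) δ_{ij} + f_ξ'(r) conj(z_i) z_j` with `r = |z|²`. Only the values of `ξ` on
`[0, ∞)` matter: for `z = 0` the second term vanishes. -/
def IsGeneratedBy {n : ℕ} (g : (Fin n → ℂ) → Matrix (Fin n) (Fin n) ℂ) (ξ : ℝ → ℝ) : Prop :=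
  ContDiffOn ℝ ∞ ξ (Set.Ici 0) ∧ ξ 0 = 0 ∧
    ∃ c : ℝ, 0 < c ∧ ∀ z i j, g z i j =
      ((fGen ξ c (sqNorm z) : ℝ) : ℂ) * (if i = j then 1 else 0)
        + ((deriv (fGen ξ c) (sqNorm z) : ℝ) : ℂ) * conj (z i) * z j

/-- There are `0 ≤ α ≤ β < 1` and `γ` with `∫_a^r (α-ξ)/s ds ≤ γ` and `∫_a^r (ξ-β)/s ds ≤ γ`
for all `0 < a < r`. -/
def CondC1 (ξ : ℝ → ℝ) : Prop :=
  ∃ α β γ : ℝ, 0 ≤ α ∧ α ≤ β ∧ β < 1 ∧ ∀ a r : ℝ, 0 < a → a < r →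
    (∫ s in a..r, (α - ξ s) / s) ≤ γ ∧ (∫ s in a..r, (ξ s - β) / s) ≤ γ

/-- `ξ(r) → 1`, `∫_1^∞ (1-ξ)/s ds = ∞` (as an improper integral), and for some `δ > 0`,
`∫_a^r (1-ξ)/s ds ≥ -δ` for all `0 < a < r`. -/
def CondC2 (ξ : ℝ → ℝ) : Prop :=
  Filter.Tendsto ξ Filter.atTop (nhds 1) ∧
  Filter.Tendsto (fun r : ℝ => ∫ s in (1 : ℝ)..r, (1 - ξ s) / s) Filter.atTop Filter.atTop ∧
  ∃ δ : ℝ, 0 < δ ∧ ∀ a r : ℝ, 0 < a → a < r → -δ ≤ ∫ s in a..r, (1 - ξ s) / s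

end UnKahler

end

open scoped ContDiff ComplexConjugate

namespace UnKahler

open Finset

/-! ### Wirtinger calculus -/

section Wirtinger

variable {n : ℕ} {F G : (Fin n → ℂ) → ℂ} {z : Fin n → ℂ} (k : Fin n)

/-! A radial metric is determined by `F` and `H = F + r F'`: with respect to the Euclidean metric
its eigenvalue is `H` along `z` and `F` on the orthogonal complement, and `F` is the average of `H`
over `[0, r]`. Two such metrics are therefore compared by comparing the functions `H` alone.

Write `H = e^V`. The curvature has three independent coefficients: tangential, mixed and radial. The
radial one, in a unit frame, is `-(V' + r V'') e^(-V)`. Integrating the bound `|V' + r V''| ≤ K e^V`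
from the origin bounds the other two as well (`curvBoundedBy_radialMetric`), so everything reduces
to one scalar inequality.

In the variable `t = log r`, the function `u = V + t` must satisfy `|u_tt| ≤ K e^u`. Where `u` is
bounded below, a bound on `u_tt` is enough. Let `ψ(t) = log (r h(r))`. Either condition on `ξ` gives
`ψ` bounded oscillation on unit intervals and makes it tend to infinity. Smoothing replaces `ψ` by
some `Ψ` at bounded distance, with bounded first and second derivatives (`exists_smooth_approx`).

The new profile starts as a cigar, whose end is a cylinder with `u ≈ 0`, and later adds the smooth
positive part of `Ψ - M`. A small cigar parameter `μ` and a large `M` push the profile below `ε h`.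
Neither spoils the curvature bound: the cigar's bound is scale invariant, and truncation at height
`M` has second derivative bounded independently of `M`. Far out `u` and `ψ` differ by a bounded
amount, which gives the upper comparison (`exists_profile`). -/

lemma dz_add (hF : DifferentiableAt ℝ F z) (hG : DifferentiableAt ℝ G z) :
    dz k (fun w => F w + G w) z = dz k F z + dz k G z := by
  simp only [dz, fderiv_fun_add hF hG, add_apply]
  ring

lemma dzbar_add (hF : DifferentiableAt ℝ F z) (hG : DifferentiableAt ℝ G z) :
    dzbar k (fun w => F w + G w) z = dzbar k F z + dzbar k G z := by
  simp only [dzbar, fderiv_fun_add hF hG, add_apply]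
  ring

lemma dz_mul (hF : DifferentiableAt ℝ F z) (hG : DifferentiableAt ℝ G z) :
    dz k (fun w => F w * G w) z = dz k F z * G z + F z * dz k G z := by
  simp only [dz, fderiv_fun_mul hF hG, add_apply,
    smul_apply, smul_eq_mul]
  ring

lemma dzbar_mul (hF : DifferentiableAt ℝ F z) (hG : DifferentiableAt ℝ G z) :
    dzbar k (fun w => F w * G w) z = dzbar k F z * G z + F z * dzbar k G z := by
  simp only [dzbar, fderiv_fun_mul hF hG, add_apply,
    smul_apply, smul_eq_mul]
  ring

lemma dz_const (c : ℂ) : dz k (fun _ : Fin n → ℂ => c) z = 0 := by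
  simp [dz]

lemma dzbar_const (c : ℂ) : dzbar k (fun _ : Fin n → ℂ => c) z = 0 := by
  simp [dzbar]

lemma hasFDerivAt_coord (i : Fin n) :
    HasFDerivAt (fun w : Fin n → ℂ => w i)
      (ContinuousLinearMap.proj (R := ℝ) (φ := fun _ : Fin n => ℂ) i) z :=
  (ContinuousLinearMap.proj (R := ℝ) (φ := fun _ : Fin n => ℂ) i).hasFDerivAt

lemma hasFDerivAt_conj_coord (i : Fin n) :
    HasFDerivAt (fun w : Fin n → ℂ => conj (w i))
      ((Complex.conjCLE : ℂ →L[ℝ] ℂ).comp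
        (ContinuousLinearMap.proj (R := ℝ) (φ := fun _ : Fin n => ℂ) i)) z :=
  ((Complex.conjCLE : ℂ →L[ℝ] ℂ).comp
        (ContinuousLinearMap.proj (R := ℝ) (φ := fun _ : Fin n => ℂ) i)).hasFDerivAt

lemma dz_coord (i : Fin n) : dz k (fun w => w i) z = if i = k then 1 else 0 := by
  rw [dz, (hasFDerivAt_coord i).fderiv]
  by_cases h : i = k
  · subst h
    simp only [ContinuousLinearMap.proj_apply, Pi.single_eq_same, Complex.I_mul_I, if_true]
    ring
  · simp [h]

lemma dzbar_coord (i : Fin n) : dzbar k (fun w => w i) z = 0 := by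
  rw [dzbar, (hasFDerivAt_coord i).fderiv]
  by_cases h : i = k
  · subst h
    simp [Complex.I_mul_I]
  · simp [h]

lemma dz_conj_coord (i : Fin n) : dz k (fun w => conj (w i)) z = 0 := by
  rw [dz, (hasFDerivAt_conj_coord i).fderiv]
  by_cases h : i = k
  · subst h
    simp [Complex.I_mul_I]
  · simp [h]

lemma dzbar_conj_coord (i : Fin n) :
    dzbar k (fun w => conj (w i)) z = if i = k then 1 else 0 := by
  rw [dzbar, (hasFDerivAt_conj_coord i).fderiv]
  by_cases h : i = k
  · subst h
    simp [Complex.I_mul_I]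
    norm_num
  · simp [h]

lemma hasFDerivAt_sqNorm (z : Fin n → ℂ) :
    HasFDerivAt (sqNorm : (Fin n → ℂ) → ℝ)
      (∑ i, ((2 * (z i).re) • Complex.reCLM.comp
          (ContinuousLinearMap.proj (R := ℝ) (φ := fun _ : Fin n => ℂ) i)
        + (2 * (z i).im) • Complex.imCLM.comp
          (ContinuousLinearMap.proj (R := ℝ) (φ := fun _ : Fin n => ℂ) i))) z := by
  unfold sqNorm
  refine HasFDerivAt.fun_sum fun i _ => ?_
  have hre : HasFDerivAt (fun w : Fin n → ℂ => (w i).re) (Complex.reCLM.comp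
      (ContinuousLinearMap.proj (R := ℝ) (φ := fun _ : Fin n => ℂ) i)) z :=
    (Complex.reCLM.comp
      (ContinuousLinearMap.proj (R := ℝ) (φ := fun _ : Fin n => ℂ) i)).hasFDerivAt
  have him : HasFDerivAt (fun w : Fin n → ℂ => (w i).im) (Complex.imCLM.comp
      (ContinuousLinearMap.proj (R := ℝ) (φ := fun _ : Fin n => ℂ) i)) z :=
    (Complex.imCLM.comp
      (ContinuousLinearMap.proj (R := ℝ) (φ := fun _ : Fin n => ℂ) i)).hasFDerivAt
  have h := (hre.mul hre).add (him.mul him)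
  simp only [Complex.normSq_apply]
  refine h.congr_fderiv ?_
  rw [two_mul, two_mul, add_smul, add_smul]

lemma contDiff_sqNorm : ContDiff ℝ ∞ (sqNorm : (Fin n → ℂ) → ℝ) := by
  unfold sqNorm
  refine ContDiff.sum fun i _ => ?_
  have h : ContDiff ℝ ∞ (fun w : Fin n → ℂ => w i) := contDiff_apply ℝ ℂ i
  have hre := Complex.reCLM.contDiff.comp h
  have him := Complex.imCLM.contDiff.comp h
  simp only [Complex.normSq_apply]
  exact (hre.mul hre).add (him.mul him)

lemma hasFDerivAt_radial {φ : ℝ → ℝ} (hφ : DifferentiableAt ℝ φ (sqNorm z)) :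
    HasFDerivAt (fun w : Fin n → ℂ => ((φ (sqNorm w) : ℝ) : ℂ))
      (Complex.ofRealCLM.comp ((deriv φ (sqNorm z)) •
        (∑ i, ((2 * (z i).re) • Complex.reCLM.comp
          (ContinuousLinearMap.proj (R := ℝ) (φ := fun _ : Fin n => ℂ) i)
        + (2 * (z i).im) • Complex.imCLM.comp
          (ContinuousLinearMap.proj (R := ℝ) (φ := fun _ : Fin n => ℂ) i))))) z := by
  have h := hφ.hasDerivAt.comp_hasFDerivAt z (hasFDerivAt_sqNorm z)
  exact Complex.ofRealCLM.hasFDerivAt.comp z h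

lemma dz_radial {φ : ℝ → ℝ} (hφ : DifferentiableAt ℝ φ (sqNorm z)) :
    dz k (fun w : Fin n → ℂ => ((φ (sqNorm w) : ℝ) : ℂ)) z
      = ((deriv φ (sqNorm z) : ℝ) : ℂ) * conj (z k) := by
  rw [dz, (hasFDerivAt_radial hφ).fderiv]
  simp [Pi.single_apply, apply_ite Complex.re,
    apply_ite Complex.im]
  apply Complex.ext <;> simp <;> ring

lemma dzbar_radial {φ : ℝ → ℝ} (hφ : DifferentiableAt ℝ φ (sqNorm z)) :
    dzbar k (fun w : Fin n → ℂ => ((φ (sqNorm w) : ℝ) : ℂ)) z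
      = ((deriv φ (sqNorm z) : ℝ) : ℂ) * z k := by
  rw [dzbar, (hasFDerivAt_radial hφ).fderiv]
  simp [Pi.single_apply, apply_ite Complex.re,
    apply_ite Complex.im]
  apply Complex.ext <;> simp <;> ring

end Wirtinger

/-! ### Radial metrics -/

/-- The matrix field `F(r) δ_{ij} + F'(r) conj(z_i) z_j`, `r = |z|²`. -/
noncomputable def radialMetric {n : ℕ} (F : ℝ → ℝ) (z : Fin n → ℂ) : Matrix (Fin n) (Fin n) ℂ :=
  fun i j => ((F (sqNorm z) : ℝ) : ℂ) * (if i = j then 1 else 0)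
    + ((deriv F (sqNorm z) : ℝ) : ℂ) * conj (z i) * z j

/-- The standard Hermitian product on `ℂⁿ`, linear in the first variable. -/
def ip {n : ℕ} (X Y : Fin n → ℂ) : ℂ := ∑ i, X i * conj (Y i)

/-! ### Eigenvalues and unitary invariance of radial metrics. -/

section Algebra

variable {n : ℕ}

lemma ip_self (X : Fin n → ℂ) : ip X X = (sqNorm X : ℂ) := by
  simp [ip, sqNorm, Complex.mul_conj]

lemma conj_ip (X Y : Fin n → ℂ) : conj (ip X Y) = ip Y X := by
  simp [ip, mul_comm]

lemma sqNorm_nonneg (X : Fin n → ℂ) : 0 ≤ sqNorm X :=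
  Finset.sum_nonneg fun _ _ => Complex.normSq_nonneg _

lemma sqNorm_pos {X : Fin n → ℂ} (hX : X ≠ 0) : 0 < sqNorm X := by
  obtain ⟨i, hi⟩ := Function.ne_iff.mp hX
  exact Finset.sum_pos' (fun _ _ => Complex.normSq_nonneg _)
    ⟨i, Finset.mem_univ _, Complex.normSq_pos.mpr hi⟩

lemma sqNorm_eq_zero {X : Fin n → ℂ} (h : sqNorm X = 0) : X = 0 := by
  by_contra hX
  exact (sqNorm_pos hX).ne' h

lemma ip_mulVec {U : Matrix (Fin n) (Fin n) ℂ} (hU : U ∈ Matrix.unitaryGroup (Fin n) ℂ)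
    (X Y : Fin n → ℂ) : ip (U.mulVec X) (U.mulVec Y) = ip X Y := by
  have h : ∀ A B : Fin n → ℂ, ip A B = A ⬝ᵥ star B := fun A B => rfl
  have hU' : star U * U = 1 := Matrix.mem_unitaryGroup_iff'.mp hU
  rw [h, h, Matrix.star_mulVec, dotProduct_comm, ← Matrix.dotProduct_mulVec,
    Matrix.mulVec_mulVec, ← Matrix.star_eq_conjTranspose, hU', Matrix.one_mulVec, dotProduct_comm]

lemma sqNorm_mulVec {U : Matrix (Fin n) (Fin n) ℂ} (hU : U ∈ Matrix.unitaryGroup (Fin n) ℂ)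
    (X : Fin n → ℂ) : sqNorm (U.mulVec X) = sqNorm X := by
  have h := ip_mulVec hU X X
  rw [ip_self, ip_self] at h
  exact_mod_cast h

lemma norm_ip_le (X Y : Fin n → ℂ) : ‖ip X Y‖ ≤ √(sqNorm X) * √(sqNorm Y) := by
  have h1 : ‖ip X Y‖ ≤ ∑ i, ‖X i‖ * ‖Y i‖ := by
    refine (norm_sum_le _ _).trans (le_of_eq ?_)
    simp
  refine h1.trans ?_
  have h2 := Real.sum_mul_le_sqrt_mul_sqrt univ (fun i => ‖X i‖) (fun i => ‖Y i‖)
  simpa only [sqNorm, Complex.normSq_eq_norm_sq] using h2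

lemma herm_radialMetric (F : ℝ → ℝ) (z X Y : Fin n → ℂ) :
    herm (radialMetric F) z X Y = (F (sqNorm z) : ℂ) * ip X Y
      + ((deriv F (sqNorm z) : ℝ) : ℂ) * ip X z * ip z Y := by
  have h1 : ∀ i, ∑ j, radialMetric F z i j * X i * conj (Y j)
      = (F (sqNorm z) : ℂ) * (X i * conj (Y i))
        + ((deriv F (sqNorm z) : ℝ) : ℂ) * (X i * conj (z i)) * ip z Y := by
    intro i
    simp only [radialMetric, add_mul, Finset.sum_add_distrib, mul_ite, ite_mul, mul_one, mul_zero,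
      zero_mul, Finset.sum_ite_eq, Finset.mem_univ, if_true, ip, Finset.mul_sum]
    congr 1
    · ring
    · exact Finset.sum_congr rfl fun j _ => by ring
  simp only [herm, h1, Finset.sum_add_distrib, ← Finset.mul_sum, ← Finset.sum_mul]
  rfl

lemma isUnitaryInvariant_radialMetric (F : ℝ → ℝ) :
    IsUnitaryInvariant (radialMetric F : (Fin n → ℂ) → _) := by
  intro U hU z X Y
  simp only [herm_radialMetric, ip_mulVec hU, sqNorm_mulVec hU]

/-- The component of `X` orthogonal to `z` (which is `X` itself for `z = 0`). -/
noncomputable def perp (z X : Fin n → ℂ) : Fin n → ℂ := fun i => X i - ip X z / sqNorm z * z i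

lemma ip_perp {z : Fin n → ℂ} (hz : sqNorm z ≠ 0) (X Y : Fin n → ℂ) :
    ip (perp z X) (perp z Y) = ip X Y - ip X z * ip z Y / sqNorm z := by
  have hz' : (sqNorm z : ℂ) ≠ 0 := by exact_mod_cast hz
  have h1 : ip (perp z X) (perp z Y) = ip X Y - (ip z Y / sqNorm z) * ip X z
      - (ip X z / sqNorm z) * ip z Y
      + (ip X z / sqNorm z) * (ip z Y / sqNorm z) * ip z z := by
    have h2 : ∀ i, perp z X i * conj (perp z Y i) = X i * conj (Y i)
        - (ip z Y / sqNorm z) * (X i * conj (z i)) - (ip X z / sqNorm z) * (z i * conj (Y i))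
        + (ip X z / sqNorm z) * (ip z Y / sqNorm z) * (z i * conj (z i)) := by
      intro i
      simp only [perp, map_sub, map_mul, map_div₀, Complex.conj_ofReal, conj_ip]
      ring
    rw [ip, Finset.sum_congr rfl fun i _ => h2 i, Finset.sum_add_distrib,
      Finset.sum_sub_distrib, Finset.sum_sub_distrib, ← Finset.mul_sum, ← Finset.mul_sum,
      ← Finset.mul_sum]
    rfl
  rw [h1, ip_self z]
  field_simp
  ring

lemma sqNorm_perp {z : Fin n → ℂ} (hz : sqNorm z ≠ 0) (X : Fin n → ℂ) :
    sqNorm (perp z X) = sqNorm X - ‖ip X z‖ ^ 2 / sqNorm z := by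
  have h := ip_perp hz X X
  rw [ip_self, ip_self, ← conj_ip X z, Complex.mul_conj, Complex.normSq_eq_norm_sq] at h
  exact_mod_cast h

lemma quad_radialMetric (F : ℝ → ℝ) (z X : Fin n → ℂ) :
    quad (radialMetric F) z X = F (sqNorm z) * sqNorm X
      + deriv F (sqNorm z) * ‖ip X z‖ ^ 2 := by
  rw [quad, herm_radialMetric, ip_self, mul_assoc, ← conj_ip X z, Complex.mul_conj,
    Complex.normSq_eq_norm_sq]
  norm_cast

/-- In terms of the radial and the orthogonal component. -/
lemma quad_radialMetric_eq_perp (F : ℝ → ℝ) {z : Fin n → ℂ} (hz : sqNorm z ≠ 0) (X : Fin n → ℂ) :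
    quad (radialMetric F) z X = F (sqNorm z) * sqNorm (perp z X)
      + (F (sqNorm z) + sqNorm z * deriv F (sqNorm z)) * (‖ip X z‖ ^ 2 / sqNorm z) := by
  rw [quad_radialMetric, sqNorm_perp hz]
  field_simp
  ring

end Algebra

/-! ### Derivatives of the metric components and the Kähler property. -/

section Kahler

variable {n : ℕ} {F : ℝ → ℝ}

lemma contDiff_radial (hF : ContDiff ℝ ∞ F) :
    ContDiff ℝ ∞ (fun w : Fin n → ℂ => ((F (sqNorm w) : ℝ) : ℂ)) :=
  Complex.ofRealCLM.contDiff.comp (hF.comp contDiff_sqNorm)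

lemma contDiff_coord (i : Fin n) : ContDiff ℝ ∞ (fun w : Fin n → ℂ => w i) :=
  contDiff_apply ℝ ℂ i

lemma contDiff_conj_coord (i : Fin n) : ContDiff ℝ ∞ (fun w : Fin n → ℂ => conj (w i)) :=
  (Complex.conjCLE : ℂ →L[ℝ] ℂ).contDiff.comp (contDiff_coord i)

lemma contDiff_deriv (hF : ContDiff ℝ ∞ F) : ContDiff ℝ ∞ (deriv F) :=
  (contDiff_infty_iff_deriv.mp hF).2

lemma _root_.ContDiff.differentiable_infty {E E' : Type*} [NormedAddCommGroup E]
    [NormedSpace ℝ E] [NormedAddCommGroup E'] [NormedSpace ℝ E'] {f : E → E'}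
    (hf : ContDiff ℝ ∞ f) : Differentiable ℝ f :=
  hf.differentiable (by simp)

lemma dz_radialMetric (hF : ContDiff ℝ ∞ F) (z : Fin n → ℂ) (i j k : Fin n) :
    dz k (fun w => radialMetric F w i j) z
      = ((deriv F (sqNorm z) : ℝ) : ℂ) * (conj (z k) * (if i = j then 1 else 0)
          + conj (z i) * (if j = k then 1 else 0))
        + ((deriv (deriv F) (sqNorm z) : ℝ) : ℂ) * conj (z k) * conj (z i) * z j := by
  have h0 := (contDiff_radial (n := n) hF).differentiable_infty
  have h1 := (contDiff_radial (n := n) (contDiff_deriv hF)).differentiable_infty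
  have hc := (contDiff_conj_coord i).differentiable_infty
  have hj := (contDiff_coord j).differentiable_infty
  simp only [radialMetric]
  rw [dz_add k ((h0 z).mul_const _) (((h1 z).fun_mul (hc z)).fun_mul (hj z)),
    dz_mul k (h0 z) (differentiableAt_const _), dz_mul k ((h1 z).fun_mul (hc z)) (hj z),
    dz_mul k (h1 z) (hc z), dz_const, dz_radial k (hF.differentiable_infty _),
    dz_radial k ((contDiff_deriv hF).differentiable_infty _), dz_conj_coord, dz_coord]
  ring

lemma dzbar_radialMetric (hF : ContDiff ℝ ∞ F) (z : Fin n → ℂ) (i j l : Fin n) :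
    dzbar l (fun w => radialMetric F w i j) z
      = ((deriv F (sqNorm z) : ℝ) : ℂ) * (z l * (if i = j then 1 else 0)
          + z j * (if i = l then 1 else 0))
        + ((deriv (deriv F) (sqNorm z) : ℝ) : ℂ) * z l * conj (z i) * z j := by
  have h0 := (contDiff_radial (n := n) hF).differentiable_infty
  have h1 := (contDiff_radial (n := n) (contDiff_deriv hF)).differentiable_infty
  have hc := (contDiff_conj_coord i).differentiable_infty
  have hj := (contDiff_coord j).differentiable_infty
  simp only [radialMetric]
  rw [dzbar_add l ((h0 z).mul_const _) (((h1 z).fun_mul (hc z)).fun_mul (hj z)),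
    dzbar_mul l (h0 z) (differentiableAt_const _), dzbar_mul l ((h1 z).fun_mul (hc z)) (hj z),
    dzbar_mul l (h1 z) (hc z), dzbar_const, dzbar_radial l (hF.differentiable_infty _),
    dzbar_radial l ((contDiff_deriv hF).differentiable_infty _), dzbar_conj_coord, dzbar_coord]
  ring

lemma dz_dzbar_radialMetric (hF : ContDiff ℝ ∞ F) (z : Fin n → ℂ) (i j k l : Fin n) :
    dz k (dzbar l (fun w => radialMetric F w i j)) z
      = ((deriv F (sqNorm z) : ℝ) : ℂ) * ((if i = j then 1 else 0) * (if k = l then 1 else 0)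
          + (if i = l then 1 else 0) * (if j = k then 1 else 0))
        + ((deriv (deriv F) (sqNorm z) : ℝ) : ℂ) *
          (conj (z k) * z l * (if i = j then 1 else 0) + conj (z k) * z j * (if i = l then 1 else 0)
          + conj (z i) * z j * (if k = l then 1 else 0)
          + conj (z i) * z l * (if j = k then 1 else 0))
        + ((deriv (deriv (deriv F)) (sqNorm z) : ℝ) : ℂ) * conj (z k) * z l * conj (z i) * z j := by
  have h1 := (contDiff_radial (n := n) (contDiff_deriv hF)).differentiable_infty
  have h2 := (contDiff_radial (n := n) (contDiff_deriv (contDiff_deriv hF))).differentiable_infty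
  have hc := (contDiff_conj_coord i).differentiable_infty
  have hj := (contDiff_coord j).differentiable_infty
  have hl := (contDiff_coord l).differentiable_infty
  have hfun : dzbar l (fun w => radialMetric F w i j) = fun z =>
      ((deriv F (sqNorm z) : ℝ) : ℂ) * (z l * (if i = j then 1 else 0)
          + z j * (if i = l then 1 else 0))
        + ((deriv (deriv F) (sqNorm z) : ℝ) : ℂ) * z l * conj (z i) * z j :=
    funext fun z => dzbar_radialMetric hF z i j l
  have hA : DifferentiableAt ℝ (fun w : Fin n → ℂ => w l * (if i = j then (1 : ℂ) else 0)
      + w j * (if i = l then 1 else 0)) z :=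
    ((hl z).mul_const _).fun_add ((hj z).mul_const _)
  have hB := (h2 z).fun_mul (hl z)
  rw [hfun, dz_add k ((h1 z).fun_mul hA) ((hB.fun_mul (hc z)).fun_mul (hj z)),
    dz_mul k (h1 z) hA, dz_add k ((hl z).mul_const _) ((hj z).mul_const _),
    dz_mul k (hl z) (differentiableAt_const _), dz_mul k (hj z) (differentiableAt_const _),
    dz_mul k (hB.fun_mul (hc z)) (hj z), dz_mul k hB (hc z), dz_mul k (h2 z) (hl z),
    dz_const, dz_const, dz_radial k ((contDiff_deriv hF).differentiable_infty _),
    dz_radial k ((contDiff_deriv (contDiff_deriv hF)).differentiable_infty _), dz_conj_coord,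
    dz_coord, dz_coord]
  simp only [eq_comm (a := l) (b := k)]
  ring

/-- The two hypotheses are positivity of the eigenvalues on the complement of `z` and along `z`; at
`z = 0` only the first is needed. -/
lemma quad_radialMetric_pos {z X : Fin n → ℂ} (hF : 0 < F (sqNorm z))
    (hH : 0 < F (sqNorm z) + sqNorm z * deriv F (sqNorm z)) (hX : X ≠ 0) :
    0 < quad (radialMetric F) z X := by
  by_cases hz : sqNorm z = 0
  · have hz0 := sqNorm_eq_zero hz
    rw [quad_radialMetric, show ip X z = 0 by simp [hz0, ip]]
    simpa using mul_pos hF (sqNorm_pos hX)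
  · have hr : 0 < sqNorm z := lt_of_le_of_ne (sqNorm_nonneg z) (Ne.symm hz)
    rw [quad_radialMetric_eq_perp F hz]
    by_cases hp : perp z X = 0
    · have h := sqNorm_perp hz X
      rw [hp, show sqNorm (0 : Fin n → ℂ) = 0 by simp [sqNorm]] at h
      have h3 : 0 < ‖ip X z‖ ^ 2 / sqNorm z := by linarith [sqNorm_pos hX]
      have := mul_pos hH h3
      rw [hp, show sqNorm (0 : Fin n → ℂ) = 0 by simp [sqNorm]]
      linarith
    · have h1 := mul_pos hF (sqNorm_pos hp)
      have : 0 ≤ (F (sqNorm z) + sqNorm z * deriv F (sqNorm z)) * (‖ip X z‖ ^ 2 / sqNorm z) := by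
        positivity
      linarith

theorem isKahlerMetric_radialMetric (hF : ContDiff ℝ ∞ F) (hpos : ∀ r, 0 ≤ r → 0 < F r)
    (hH : ∀ r, 0 ≤ r → 0 < F r + r * deriv F r) :
    IsKahlerMetric (radialMetric F : (Fin n → ℂ) → _) where
  smooth i j := ((contDiff_radial hF).mul contDiff_const).add
    (((contDiff_radial (contDiff_deriv hF)).mul (contDiff_conj_coord i)).mul (contDiff_coord j))
  hermitian z := by
    ext i j
    simp only [Matrix.conjTranspose_apply, radialMetric, eq_comm (a := j) (b := i)]
    by_cases h : i = j <;> simp [h] <;> ring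
  pos z X hX := quad_radialMetric_pos (hpos _ (sqNorm_nonneg z)) (hH _ (sqNorm_nonneg z)) hX
  closed z i j k := by
    rw [dz_radialMetric hF, dz_radialMetric hF]
    -- The derivative is already symmetric in `i` and `k`, up to the orientation of the Kronecker
    -- deltas.
    simp only [eq_comm (a := i) (b := j)]
    ring_nf
    simp only [eq_comm (a := k) (b := j)]

end Kahler

/-! ### The curvature tensor in coordinates and on four vectors. -/

section Curvature

variable {n : ℕ} {F : ℝ → ℝ}

lemma sum_coord_mul_conj (z : Fin n → ℂ) : ∑ q, z q * conj (z q) = (sqNorm z : ℂ) := ip_self z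

/-- Sherman–Morrison: the metric is a rank-one perturbation of a multiple of the identity. -/
lemma inv_radialMetric {z : Fin n → ℂ} (hF : F (sqNorm z) ≠ 0)
    (hH : F (sqNorm z) + sqNorm z * deriv F (sqNorm z) ≠ 0) (q p : Fin n) :
    (radialMetric F z)⁻¹ q p = (1 / (F (sqNorm z) : ℂ)) * ((if q = p then 1 else 0)
      - ((deriv F (sqNorm z) : ℝ) : ℂ)
        / ((F (sqNorm z) + sqNorm z * deriv F (sqNorm z) : ℝ) : ℂ) * conj (z q) * z p) := by
  set f : ℂ := (F (sqNorm z) : ℂ) with hf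
  set d : ℂ := ((deriv F (sqNorm z) : ℝ) : ℂ) with hd
  have hf0 : f ≠ 0 := by rw [hf]; exact_mod_cast hF
  have hHc : ((F (sqNorm z) + sqNorm z * deriv F (sqNorm z) : ℝ) : ℂ) = f + sqNorm z * d := by
    rw [hf, hd]; push_cast; ring
  have hH0 : f + sqNorm z * d ≠ 0 := by rw [← hHc]; exact_mod_cast hH
  rw [hHc]
  have key : (radialMetric F z)⁻¹ = Matrix.of fun q p =>
      (1 / f) * ((if q = p then 1 else 0) - d / (f + sqNorm z * d) * conj (z q) * z p) := by
    refine Matrix.inv_eq_right_inv ?_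
    ext i p
    rw [Matrix.mul_apply]
    have h1 : ∀ j, radialMetric F z i j * (Matrix.of fun q p =>
      (1 / f) * ((if q = p then 1 else 0) - d / (f + sqNorm z * d) * conj (z q) * z p)) j p
      = (if i = j then (if j = p then 1 else 0) - d / (f + sqNorm z * d) * conj (z j) * z p
          else 0)
        + (if j = p then d / f * conj (z i) * z j else 0)
        - (d / f * (d / (f + sqNorm z * d)) * conj (z i) * z p) * (z j * conj (z j)) := by
      intro j
      simp only [radialMetric, Matrix.of_apply, ← hf, ← hd]
      split_ifs <;> field_simp <;> ring
    rw [Finset.sum_congr rfl fun j _ => h1 j, Finset.sum_sub_distrib, Finset.sum_add_distrib,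
      ← Finset.mul_sum, sum_coord_mul_conj]
    simp only [Finset.sum_ite_eq, Finset.sum_ite_eq', Finset.mem_univ, if_true, Matrix.one_apply]
    have hH1 : f + d * sqNorm z ≠ 0 := by rwa [mul_comm d]
    field_simp
    ring
  rw [key, Matrix.of_apply]

lemma sum_inv_radialMetric {z : Fin n → ℂ} (hF : F (sqNorm z) ≠ 0)
    (hH : F (sqNorm z) + sqNorm z * deriv F (sqNorm z) ≠ 0) (a b : Fin n → ℂ) :
    ∑ p, ∑ q, (radialMetric F z)⁻¹ q p * a q * b p
      = (1 / (F (sqNorm z) : ℂ)) * (∑ q, a q * b q - ((deriv F (sqNorm z) : ℝ) : ℂ)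
        / ((F (sqNorm z) + sqNorm z * deriv F (sqNorm z) : ℝ) : ℂ)
          * (∑ q, conj (z q) * a q) * ∑ p, z p * b p) := by
  have h1 : ∀ p, ∑ q, (radialMetric F z)⁻¹ q p * a q * b p
      = (1 / (F (sqNorm z) : ℂ)) * (a p * b p - ((deriv F (sqNorm z) : ℝ) : ℂ)
        / ((F (sqNorm z) + sqNorm z * deriv F (sqNorm z) : ℝ) : ℂ)
          * (∑ q, conj (z q) * a q) * (z p * b p)) := by
    intro p
    have h2 : ∀ q, (radialMetric F z)⁻¹ q p * a q * b p
        = (if q = p then (1 / (F (sqNorm z) : ℂ)) * (a q * b p) else 0)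
        - (1 / (F (sqNorm z) : ℂ)) * (((deriv F (sqNorm z) : ℝ) : ℂ)
        / ((F (sqNorm z) + sqNorm z * deriv F (sqNorm z) : ℝ) : ℂ))
          * (z p * b p) * (conj (z q) * a q) := by
      intro q
      rw [inv_radialMetric hF hH]
      split_ifs <;> ring
    rw [Finset.sum_congr rfl fun q _ => h2 q, Finset.sum_sub_distrib, ← Finset.mul_sum]
    simp only [Finset.sum_ite_eq', Finset.mem_univ, if_true]
    ring
  rw [Finset.sum_congr rfl fun p _ => h1 p, ← Finset.mul_sum, Finset.sum_sub_distrib,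
    ← Finset.mul_sum]

/-- The curvature tensor of a radial metric in the standard coordinates. -/
lemma curv_radialMetric (hF : ContDiff ℝ ∞ F) {z : Fin n → ℂ} (hF0 : F (sqNorm z) ≠ 0)
    (hH : F (sqNorm z) + sqNorm z * deriv F (sqNorm z) ≠ 0) (i j k l : Fin n) :
    curv (radialMetric F) z i j k l
      = -((deriv F (sqNorm z) : ℝ) : ℂ) * ((if i = j then 1 else 0) * (if k = l then 1 else 0)
          + (if i = l then 1 else 0) * (if k = j then 1 else 0))
        + ((deriv F (sqNorm z) ^ 2 / F (sqNorm z) - deriv (deriv F) (sqNorm z) : ℝ) : ℂ) *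
          (conj (z k) * z l * (if i = j then 1 else 0) + conj (z k) * z j * (if i = l then 1 else 0)
          + conj (z i) * z j * (if k = l then 1 else 0)
          + conj (z i) * z l * (if k = j then 1 else 0))
        + ((-deriv (deriv (deriv F)) (sqNorm z)
            + (4 * deriv F (sqNorm z) * deriv (deriv F) (sqNorm z)
              + sqNorm z * deriv (deriv F) (sqNorm z) ^ 2) / F (sqNorm z)
            - deriv F (sqNorm z)
              * (2 * deriv F (sqNorm z) + sqNorm z * deriv (deriv F) (sqNorm z)) ^ 2
              / (F (sqNorm z) * (F (sqNorm z) + sqNorm z * deriv F (sqNorm z))) : ℝ) : ℂ)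
            * (conj (z i) * z j * conj (z k) * z l) := by
  rw [curv, dz_dzbar_radialMetric hF]
  simp only [dz_radialMetric hF, dzbar_radialMetric hF]
  rw [sum_inv_radialMetric hF0 hH]
  set f : ℂ := (F (sqNorm z) : ℂ) with hf
  set d : ℂ := ((deriv F (sqNorm z) : ℝ) : ℂ) with hd
  set e : ℂ := ((deriv (deriv F) (sqNorm z) : ℝ) : ℂ) with he
  have hf0 : f ≠ 0 := by rw [hf]; exact_mod_cast hF0
  have hHc : ((F (sqNorm z) + sqNorm z * deriv F (sqNorm z) : ℝ) : ℂ) = f + sqNorm z * d := by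
    rw [hf, hd]; push_cast; ring
  have hH0 : f + sqNorm z * d ≠ 0 := by rw [← hHc]; exact_mod_cast hH
  have hza : ∑ q, conj (z q) * (d * (conj (z k) * (if i = q then 1 else 0)
      + conj (z i) * (if q = k then 1 else 0)) + e * conj (z k) * conj (z i) * z q)
      = conj (z i) * conj (z k) * (2 * d + sqNorm z * e) := by
    have : ∀ q, conj (z q) * (d * (conj (z k) * (if i = q then 1 else 0)
      + conj (z i) * (if q = k then 1 else 0)) + e * conj (z k) * conj (z i) * z q)
      = (if i = q then conj (z q) * d * conj (z k) else 0)
        + (if q = k then conj (z q) * d * conj (z i) else 0)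
        + e * conj (z k) * conj (z i) * (z q * conj (z q)) := by
      intro q; split_ifs <;> ring
    rw [Finset.sum_congr rfl fun q _ => this q, Finset.sum_add_distrib, Finset.sum_add_distrib,
      ← Finset.mul_sum, sum_coord_mul_conj]
    simp only [Finset.sum_ite_eq', Finset.sum_ite_eq, Finset.mem_univ, if_true]
    ring
  have hzb : ∑ q, z q * (d * (z l * (if q = j then 1 else 0)
      + z j * (if q = l then 1 else 0)) + e * z l * conj (z q) * z j)
      = z j * z l * (2 * d + sqNorm z * e) := by
    have : ∀ q, z q * (d * (z l * (if q = j then 1 else 0)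
      + z j * (if q = l then 1 else 0)) + e * z l * conj (z q) * z j)
      = (if q = j then z q * d * z l else 0) + (if q = l then z q * d * z j else 0)
        + e * z l * z j * (z q * conj (z q)) := by
      intro q; split_ifs <;> ring
    rw [Finset.sum_congr rfl fun q _ => this q, Finset.sum_add_distrib, Finset.sum_add_distrib,
      ← Finset.mul_sum, sum_coord_mul_conj]
    simp only [Finset.sum_ite_eq', Finset.mem_univ, if_true]
    ring
  -- With `b` arbitrary, the deltas evaluate `b` at `i` and `k`, and the remaining sum is the one
  -- computed in `hzb`.
  have hab : ∀ b : Fin n → ℂ, ∑ q, (d * (conj (z k) * (if i = q then 1 else 0)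
      + conj (z i) * (if q = k then 1 else 0)) + e * conj (z k) * conj (z i) * z q) * b q
      = d * (conj (z k) * b i + conj (z i) * b k) + e * conj (z k) * conj (z i)
        * ∑ q, z q * b q := by
    intro b
    have : ∀ q, (d * (conj (z k) * (if i = q then 1 else 0)
      + conj (z i) * (if q = k then 1 else 0)) + e * conj (z k) * conj (z i) * z q) * b q
      = (if i = q then d * conj (z k) * b q else 0) + (if q = k then d * conj (z i) * b q else 0)
        + e * conj (z k) * conj (z i) * (z q * b q) := by
      intro q; split_ifs <;> ring
    rw [Finset.sum_congr rfl fun q _ => this q, Finset.sum_add_distrib, Finset.sum_add_distrib,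
      ← Finset.mul_sum]
    simp only [Finset.sum_ite_eq', Finset.sum_ite_eq, Finset.mem_univ, if_true]
    ring
  rw [hza, hab, hzb]
  push_cast
  simp only [← hf, ← hd, ← he, eq_comm (a := j) (b := k)]
  field_simp
  ring

/-- The value of the curvature tensor of a radial metric on four vectors. -/
lemma sum_curv_radialMetric {z : Fin n → ℂ} {α β γ : ℂ} {R : Fin n → Fin n → Fin n → Fin n → ℂ}
    (hR : ∀ i j k l, R i j k l
      = -α * ((if i = j then 1 else 0) * (if k = l then 1 else 0)
          + (if i = l then 1 else 0) * (if k = j then 1 else 0))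
        + β * (conj (z k) * z l * (if i = j then 1 else 0)
          + conj (z k) * z j * (if i = l then 1 else 0)
          + conj (z i) * z j * (if k = l then 1 else 0)
          + conj (z i) * z l * (if k = j then 1 else 0))
        + γ * (conj (z i) * z j * conj (z k) * z l)) (X Y Z W : Fin n → ℂ) :
    ∑ i, ∑ j, ∑ k, ∑ l, R i j k l * X i * conj (Y j) * Z k * conj (W l)
      = -α * (ip X Y * ip Z W + ip X W * ip Z Y)
        + β * (ip X Y * (ip Z z * ip z W) + ip X W * (ip Z z * ip z Y)
          + ip Z W * (ip X z * ip z Y) + ip Z Y * (ip X z * ip z W))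
        + γ * (ip X z * ip z Y * ip Z z * ip z W) := by
  -- The indices are contracted one at a time, from the innermost: each delta substitutes an index,
  -- each factor of `z` produces a product `ip`.
  have hl : ∀ i j k, ∑ l, R i j k l * X i * conj (Y j) * Z k * conj (W l)
      = X i * conj (Y j) * Z k * (-α * ((if i = j then 1 else 0) * conj (W k)
          + conj (W i) * (if k = j then 1 else 0))
        + β * (conj (z k) * ip z W * (if i = j then 1 else 0)
          + conj (z k) * z j * conj (W i)
          + conj (z i) * z j * conj (W k)
          + conj (z i) * ip z W * (if k = j then 1 else 0))
        + γ * (conj (z i) * z j * conj (z k) * ip z W)) := by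
    intro i j k
    have : ∀ l, R i j k l * X i * conj (Y j) * Z k * conj (W l)
      = (if k = l then X i * conj (Y j) * Z k * (-α * (if i = j then 1 else 0)
          + β * (conj (z i) * z j)) * conj (W l) else 0)
        + (if i = l then X i * conj (Y j) * Z k * (-α * (if k = j then 1 else 0)
          + β * (conj (z k) * z j)) * conj (W l) else 0)
        + X i * conj (Y j) * Z k * (β * (conj (z k) * (if i = j then 1 else 0)
          + conj (z i) * (if k = j then 1 else 0))
        + γ * (conj (z i) * z j * conj (z k))) * (z l * conj (W l)) := by
      intro l
      rw [hR]
      split_ifs <;> ring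
    rw [Finset.sum_congr rfl fun l _ => this l, Finset.sum_add_distrib, Finset.sum_add_distrib,
      ← Finset.mul_sum]
    simp only [Finset.sum_ite_eq, Finset.mem_univ, if_true]
    rw [← ip]
    ring
  have hk : ∀ i j, ∑ k, ∑ l, R i j k l * X i * conj (Y j) * Z k * conj (W l)
      = X i * conj (Y j) * (-α * ((if i = j then 1 else 0) * ip Z W
          + conj (W i) * Z j)
        + β * (ip Z z * ip z W * (if i = j then 1 else 0)
          + ip Z z * z j * conj (W i)
          + conj (z i) * z j * ip Z W
          + conj (z i) * ip z W * Z j)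
        + γ * (conj (z i) * z j * ip Z z * ip z W)) := by
    intro i j
    have : ∀ k, ∑ l, R i j k l * X i * conj (Y j) * Z k * conj (W l)
      = (if k = j then X i * conj (Y j) * (-α * conj (W i) + β * (conj (z i) * ip z W)) * Z k
          else 0)
        + X i * conj (Y j) * (-α * (if i = j then 1 else 0) + β * (conj (z i) * z j))
          * (Z k * conj (W k))
        + X i * conj (Y j) * (β * (ip z W * (if i = j then 1 else 0) + z j * conj (W i))
          + γ * (conj (z i) * z j * ip z W)) * (Z k * conj (z k)) := by
      intro k
      rw [hl]
      split_ifs <;> ring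
    rw [Finset.sum_congr rfl fun l _ => this l, Finset.sum_add_distrib, Finset.sum_add_distrib,
      ← Finset.mul_sum, ← Finset.mul_sum]
    simp only [Finset.sum_ite_eq', Finset.mem_univ, if_true]
    rw [← ip, ← ip]
    ring
  have hj : ∀ i, ∑ j, ∑ k, ∑ l, R i j k l * X i * conj (Y j) * Z k * conj (W l)
      = X i * (-α * (conj (Y i) * ip Z W + conj (W i) * ip Z Y)
        + β * (ip Z z * ip z W * conj (Y i)
          + ip Z z * ip z Y * conj (W i)
          + conj (z i) * ip z Y * ip Z W
          + conj (z i) * ip z W * ip Z Y)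
        + γ * (conj (z i) * ip z Y * ip Z z * ip z W)) := by
    intro i
    have : ∀ j, ∑ k, ∑ l, R i j k l * X i * conj (Y j) * Z k * conj (W l)
      = (if i = j then X i * (-α * ip Z W + β * (ip Z z * ip z W)) * conj (Y j) else 0)
        + X i * (-α * conj (W i) + β * (conj (z i) * ip z W)) * (Z j * conj (Y j))
        + X i * (β * (ip Z z * conj (W i) + conj (z i) * ip Z W)
          + γ * (conj (z i) * ip Z z * ip z W)) * (z j * conj (Y j)) := by
      intro j
      rw [hk]
      split_ifs <;> ring
    rw [Finset.sum_congr rfl fun l _ => this l, Finset.sum_add_distrib, Finset.sum_add_distrib,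
      ← Finset.mul_sum, ← Finset.mul_sum]
    simp only [Finset.sum_ite_eq, Finset.mem_univ, if_true]
    rw [← ip, ← ip]
    ring
  have hi : ∀ i, ∑ j, ∑ k, ∑ l, R i j k l * X i * conj (Y j) * Z k * conj (W l)
      = (-α * ip Z W + β * (ip Z z * ip z W)) * (X i * conj (Y i))
        + (-α * ip Z Y + β * (ip Z z * ip z Y)) * (X i * conj (W i))
        + (β * (ip z Y * ip Z W + ip z W * ip Z Y) + γ * (ip z Y * ip Z z * ip z W))
          * (X i * conj (z i)) := by
    intro i
    rw [hj]
    ring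
  rw [Finset.sum_congr rfl fun l _ => hi l, Finset.sum_add_distrib, Finset.sum_add_distrib,
      ← Finset.mul_sum, ← Finset.mul_sum, ← Finset.mul_sum]
  rw [← ip, ← ip, ← ip]
  ring

end Curvature

/-! ### From the three curvature coefficients to a bound on the tensor. -/

section CurvatureBound

variable {n : ℕ} {F : ℝ → ℝ}

lemma mul_four_le_mul_four {a b c d a' b' c' d' : ℝ} (ha : 0 ≤ a) (hb : 0 ≤ b) (hc : 0 ≤ c)
    (hd : 0 ≤ d) (haa : a ≤ a') (hbb : b ≤ b') (hcc : c ≤ c') (hdd : d ≤ d') :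
    a * b * c * d ≤ a' * b' * c' * d' := by
  have ha' := ha.trans haa
  have hb' := hb.trans hbb
  have hc' := hc.trans hcc
  gcongr

lemma norm_sum_seven_le {x₁ x₂ x₃ x₄ x₅ x₆ x₇ : ℂ} {B : ℝ} (h₁ : ‖x₁‖ ≤ B) (h₂ : ‖x₂‖ ≤ B)
    (h₃ : ‖x₃‖ ≤ B) (h₄ : ‖x₄‖ ≤ B) (h₅ : ‖x₅‖ ≤ B) (h₆ : ‖x₆‖ ≤ B) (h₇ : ‖x₇‖ ≤ B) :
    ‖x₁ + x₂ + x₃ + x₄ + x₅ + x₆ + x₇‖ ≤ 7 * B := by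
  have e₁ := norm_add_le (x₁ + x₂ + x₃ + x₄ + x₅ + x₆) x₇
  have e₂ := norm_add_le (x₁ + x₂ + x₃ + x₄ + x₅) x₆
  have e₃ := norm_add_le (x₁ + x₂ + x₃ + x₄) x₅
  have e₄ := norm_add_le (x₁ + x₂ + x₃) x₄
  have e₅ := norm_add_le (x₁ + x₂) x₃
  have e₆ := norm_add_le x₁ x₂
  linarith

/-- A term `c a b d e` of the curvature tensor is bounded if the rescaled lengths of its factors
are. -/
lemma abs_coeff_mul_le {c K s₁ s₂ a b d e qa qb qd qe : ℝ} (hK : 0 ≤ K) (hs₁ : 0 ≤ s₁)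
    (hs₂ : 0 ≤ s₂)
    (hc : |c| ≤ K * (s₁ * s₁ * s₂ * s₂)) (ha : 0 ≤ a) (hb : 0 ≤ b) (hd : 0 ≤ d) (he : 0 ≤ e)
    (hqa : s₁ * a ≤ qa) (hqb : s₁ * b ≤ qb) (hqd : s₂ * d ≤ qd) (hqe : s₂ * e ≤ qe) :
    |c| * (a * b * d * e) ≤ K * (qa * qb * qd * qe) := by
  calc |c| * (a * b * d * e) ≤ K * (s₁ * s₁ * s₂ * s₂) * (a * b * d * e) := by gcongr
    _ = K * ((s₁ * a) * (s₁ * b) * (s₂ * d) * (s₂ * e)) := by ring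
    _ ≤ K * (qa * qb * qd * qe) := by
        gcongr K * ?_
        exact mul_four_le_mul_four (by positivity) (by positivity) (by positivity) (by positivity)
          hqa hqb hqd hqe

/-- Splitting vectors into their components along `z` and orthogonal to it leaves seven terms,
whence the factor 7, with only three coefficients. Since `|X|²` in the metric is `f |perp z X|² + (H
/ r) |⟨X, z⟩|²`, each component rescaled by `√f` or `√(H / r)` is at most `|X|`, and `hA`, `hB`,
`hC` are the bounds that match these scalings. -/
lemma sum_curv_radialMetric_bound (hF : ContDiff ℝ ∞ F) {z : Fin n → ℂ} {K r f f₁ f₂ f₃ H : ℝ}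
    (hr : sqNorm z = r) (hf : F r = f) (hf₁ : deriv F r = f₁) (hf₂ : deriv (deriv F) r = f₂)
    (hf₃ : deriv (deriv (deriv F)) r = f₃) (hH : f + r * f₁ = H)
    (hfpos : 0 < f) (hHpos : 0 < H) (hK : 0 ≤ K) (hA : |f₁| ≤ K * f ^ 2)
    (hB : 0 < r → |f₁ ^ 2 / f - f₂ - f₁ / r| * r ≤ K * (f * H))
    (hC : 0 < r → |-f₃ + (4 * f₁ * f₂ + r * f₂ ^ 2) / f - f₁ * (2 * f₁ + r * f₂) ^ 2 / (f * H)
      + 4 * (f₁ ^ 2 / f - f₂) / r - 2 * f₁ / r ^ 2| * r ^ 2 ≤ K * H ^ 2)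
    (X Y Z W : Fin n → ℂ) :
    ‖∑ i, ∑ j, ∑ k, ∑ l, curv (radialMetric F) z i j k l * X i * conj (Y j) * Z k * conj (W l)‖
      ≤ 7 * (K * (√(quad (radialMetric F) z X) * √(quad (radialMetric F) z Y)
        * √(quad (radialMetric F) z Z) * √(quad (radialMetric F) z W))) := by
  have hcurv := fun i j k l => curv_radialMetric (n := n) hF (z := z)
    (by rw [hr, hf]; exact hfpos.ne') (by rw [hr, hf, hf₁, hH]; exact hHpos.ne') i j k l
  rw [sum_curv_radialMetric hcurv]
  simp only [hr, hf, hf₁, hf₂, hf₃, hH]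
  have hsf : √f * √f = f := Real.mul_self_sqrt hfpos.le
  have hA' : |f₁| ≤ K * (√f * √f * √f * √f) := by
    rw [hsf, mul_assoc, hsf, ← sq]; exact hA
  set q : (Fin n → ℂ) → ℝ := fun X => √(quad (radialMetric F) z X) with hq
  -- At the origin every product with `z` vanishes and only the two tangential terms survive, so
  -- `hB` and `hC` are not needed there.
  by_cases hr0 : r = 0
  · have hz : z = 0 := sqNorm_eq_zero (hr.trans hr0)
    have hip : ∀ X : Fin n → ℂ, ip X z = 0 := by intro X; simp [hz, ip]
    have hqX : ∀ X, √f * √(sqNorm X) ≤ q X := by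
      intro X
      rw [hq]
      simp only
      rw [quad_radialMetric, hip, hr, hf, ← Real.sqrt_mul hfpos.le]
      simp
    have key : ∀ X Y Z W : Fin n → ℂ, ‖(-(f₁ : ℂ)) * (ip X Y * ip Z W)‖
        ≤ K * (q X * q Y * q Z * q W) := by
      intro X Y Z W
      rw [norm_mul, norm_mul, norm_neg, Complex.norm_real, Real.norm_eq_abs]
      refine le_trans ?_ (abs_coeff_mul_le hK (Real.sqrt_nonneg f) (Real.sqrt_nonneg f) hA'
        (Real.sqrt_nonneg _) (Real.sqrt_nonneg _) (Real.sqrt_nonneg _) (Real.sqrt_nonneg _)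
        (hqX X) (hqX Y) (hqX Z) (hqX W))
      rw [mul_assoc (√(sqNorm X) * √(sqNorm Y))]
      gcongr
      exacts [norm_ip_le X Y, norm_ip_le Z W]
    have hQ : 0 ≤ K * (q X * q Y * q Z * q W) := by positivity
    have k1 := key X Y Z W
    have k2 := key X W Z Y
    have k3 := norm_add_le ((-(f₁ : ℂ)) * (ip X Y * ip Z W)) ((-(f₁ : ℂ)) * (ip X W * ip Z Y))
    simp only [hip, zero_mul, mul_zero, add_zero, mul_add]
    have e : q X * q W * q Z * q Y = q X * q Y * q Z * q W := by ring
    rw [e] at k2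
    simp only [hq] at hQ k1 k2
    linarith
  · have hrpos : 0 < r := lt_of_le_of_ne (hr ▸ sqNorm_nonneg z) (Ne.symm hr0)
    have hz : sqNorm z ≠ 0 := by rw [hr]; exact hr0
    have hrc : (r : ℂ) ≠ 0 := by exact_mod_cast hr0
    specialize hB hrpos
    specialize hC hrpos
    set b : ℝ := f₁ ^ 2 / f - f₂ - f₁ / r with hb
    set a : ℝ := -f₃ + (4 * f₁ * f₂ + r * f₂ ^ 2) / f - f₁ * (2 * f₁ + r * f₂) ^ 2 / (f * H)
      + 4 * (f₁ ^ 2 / f - f₂) / r - 2 * f₁ / r ^ 2 with ha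
    set e : ℝ := -f₃ + (4 * f₁ * f₂ + r * f₂ ^ 2) / f - f₁ * (2 * f₁ + r * f₂) ^ 2 / (f * H)
      with he
    set N : (Fin n → ℂ) → (Fin n → ℂ) → ℂ := fun X Y => ip (perp z X) (perp z Y) with hN
    have hipN : ∀ X Y, ip X Y = N X Y + ip X z * ip z Y / r := by
      intro X Y
      rw [hN]
      simp only
      rw [ip_perp hz, hr]
      ring
    have hb' : ((f₁ ^ 2 / f - f₂ : ℝ) : ℂ) = b + f₁ / r := by
      rw [hb]; push_cast; ring
    have ha' : (e : ℂ) = a - 4 * (b + f₁ / r) / r + 2 * f₁ / r ^ 2 := by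
      rw [ha, ← hb']; push_cast; ring
    have hsH : √(H / r) * √(H / r) = H / r := Real.mul_self_sqrt (by positivity)
    have hB' : |b| ≤ K * (√f * √f * √(H / r) * √(H / r)) := by
      rw [hsf, mul_assoc, hsH, mul_div_assoc', mul_div_assoc', le_div_iff₀ hrpos]
      exact hB
    have hC' : |a| ≤ K * (√(H / r) * √(H / r) * √(H / r) * √(H / r)) := by
      rw [hsH, mul_assoc, hsH, ← sq, div_pow, mul_div_assoc', le_div_iff₀ (by positivity)]
      exact hC
    have hqperp : ∀ X, √f * √(sqNorm (perp z X)) ≤ q X := by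
      intro X
      rw [← Real.sqrt_mul hfpos.le]
      refine Real.sqrt_le_sqrt ?_
      rw [quad_radialMetric_eq_perp F hz, hr, hf, hf₁, hH]
      have : 0 ≤ H * (‖ip X z‖ ^ 2 / r) := by positivity
      linarith
    have hqrad : ∀ X, √(H / r) * ‖ip X z‖ ≤ q X := by
      intro X
      rw [← Real.sqrt_sq (norm_nonneg (ip X z)), ← Real.sqrt_mul (by positivity)]
      refine Real.sqrt_le_sqrt ?_
      rw [quad_radialMetric_eq_perp F hz, hr, hf, hf₁, hH]
      have : 0 ≤ f * sqNorm (perp z X) := mul_nonneg hfpos.le (sqNorm_nonneg _)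
      have e : H / r * ‖ip X z‖ ^ 2 = H * (‖ip X z‖ ^ 2 / r) := by ring
      linarith
    have hqrad' : ∀ X, √(H / r) * ‖ip z X‖ ≤ q X := by
      intro X
      rw [← conj_ip X z, Complex.norm_conj]
      exact hqrad X
    have k1 : ∀ X Y Z W : Fin n → ℂ, ‖(-(f₁ : ℂ)) * (N X Y * N Z W)‖
        ≤ K * (q X * q Y * q Z * q W) := by
      intro X Y Z W
      rw [norm_mul, norm_mul, norm_neg, Complex.norm_real, Real.norm_eq_abs]
      refine le_trans ?_ (abs_coeff_mul_le hK (Real.sqrt_nonneg f) (Real.sqrt_nonneg f) hA'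
        (Real.sqrt_nonneg _) (Real.sqrt_nonneg _) (Real.sqrt_nonneg _) (Real.sqrt_nonneg _)
        (hqperp X) (hqperp Y) (hqperp Z) (hqperp W))
      rw [mul_assoc (√(sqNorm (perp z X)) * √(sqNorm (perp z Y)))]
      gcongr
      exacts [norm_ip_le _ _, norm_ip_le _ _]
    have k2 : ∀ X Y Z W : Fin n → ℂ, ‖(b : ℂ) * (N X Y * (ip Z z * ip z W))‖
        ≤ K * (q X * q Y * q Z * q W) := by
      intro X Y Z W
      rw [norm_mul, norm_mul, norm_mul, Complex.norm_real, Real.norm_eq_abs]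
      refine le_trans ?_ (abs_coeff_mul_le hK (Real.sqrt_nonneg f) (Real.sqrt_nonneg _) hB'
        (Real.sqrt_nonneg _) (Real.sqrt_nonneg _) (norm_nonneg _) (norm_nonneg _)
        (hqperp X) (hqperp Y) (hqrad Z) (hqrad' W))
      rw [mul_assoc (√(sqNorm (perp z X)) * √(sqNorm (perp z Y)))]
      gcongr
      exact norm_ip_le _ _
    have k3 : ‖(a : ℂ) * (ip X z * ip z Y * ip Z z * ip z W)‖
        ≤ K * (q X * q Y * q Z * q W) := by
      rw [norm_mul, norm_mul, norm_mul, norm_mul, Complex.norm_real, Real.norm_eq_abs]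
      exact abs_coeff_mul_le hK (Real.sqrt_nonneg _) (Real.sqrt_nonneg _) hC'
        (norm_nonneg _) (norm_nonneg _) (norm_nonneg _) (norm_nonneg _)
        (hqrad X) (hqrad' Y) (hqrad Z) (hqrad' W)
    -- The coefficients `b` and `a` are what collects in front of the mixed and the purely radial
    -- products after inserting `hipN`.
    have expand : -(f₁ : ℂ) * (ip X Y * ip Z W + ip X W * ip Z Y)
        + ((f₁ ^ 2 / f - f₂ : ℝ) : ℂ) * (ip X Y * (ip Z z * ip z W) + ip X W * (ip Z z * ip z Y)
          + ip Z W * (ip X z * ip z Y) + ip Z Y * (ip X z * ip z W))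
        + (e : ℂ) * (ip X z * ip z Y * ip Z z * ip z W)
        = -(f₁ : ℂ) * (N X Y * N Z W) + -(f₁ : ℂ) * (N X W * N Z Y)
          + (b : ℂ) * (N X Y * (ip Z z * ip z W)) + (b : ℂ) * (N X W * (ip Z z * ip z Y))
          + (b : ℂ) * (N Z W * (ip X z * ip z Y)) + (b : ℂ) * (N Z Y * (ip X z * ip z W))
          + (a : ℂ) * (ip X z * ip z Y * ip Z z * ip z W) := by
      rw [ha', hb', hipN X Y, hipN Z W, hipN X W, hipN Z Y]
      field_simp
      ring
    rw [expand]
    refine norm_sum_seven_le (k1 X Y Z W) ((k1 X W Z Y).trans (le_of_eq ?_)) (k2 X Y Z W)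
      ((k2 X W Z Y).trans (le_of_eq ?_)) ((k2 Z W X Y).trans (le_of_eq ?_))
      ((k2 Z Y X W).trans (le_of_eq ?_)) k3 <;> simp only [hq] <;> ring

end CurvatureBound

/-! ### Curvature bounds from the radial curvature -/

section RadialODE

variable {F V : ℝ → ℝ} {K : ℝ}

/-- Two functions with the same value at `0` are ordered if their derivatives are. -/
lemma abs_le_of_abs_deriv_le {f g f' g' : ℝ → ℝ} (hf : ∀ x, HasDerivAt f (f' x) x)
    (hg : ∀ x, HasDerivAt g (g' x) x) (hf0 : f 0 = 0) (hg0 : g 0 = 0)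
    (hle : ∀ x, 0 < x → |f' x| ≤ g' x) {x : ℝ} (hx : 0 ≤ x) : |f x| ≤ g x := by
  have h1 : MonotoneOn (fun x => g x - f x) (Set.Ici 0) := by
    refine monotoneOn_of_deriv_nonneg (convex_Ici 0)
      (fun x _ => ((hg x).sub (hf x)).continuousAt.continuousWithinAt)
      (fun x _ => ((hg x).sub (hf x)).differentiableAt.differentiableWithinAt) fun x hx => ?_
    rw [interior_Ici] at hx
    rw [((hg x).fun_sub (hf x)).deriv]
    linarith [le_abs_self (f' x), hle x hx]
  have h2 : MonotoneOn (fun x => g x + f x) (Set.Ici 0) := by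
    refine monotoneOn_of_deriv_nonneg (convex_Ici 0)
      (fun x _ => ((hg x).add (hf x)).continuousAt.continuousWithinAt)
      (fun x _ => ((hg x).add (hf x)).differentiableAt.differentiableWithinAt) fun x hx => ?_
    rw [interior_Ici] at hx
    rw [((hg x).fun_add (hf x)).deriv]
    linarith [neg_le_abs (f' x), hle x hx]
  have e1 := h1 Set.self_mem_Ici hx hx
  have e2 := h2 Set.self_mem_Ici hx hx
  simp only [hf0, hg0] at e1 e2
  exact abs_le.mpr ⟨by linarith, by linarith⟩

/-- `F + r F' = e^V` forces `F > 0` on `[0, ∞)`. -/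
lemma pos_of_add_mul_deriv_eq_exp (hF : Differentiable ℝ F)
    (hH : ∀ r, F r + r * deriv F r = Real.exp (V r)) {r : ℝ} (hr : 0 ≤ r) : 0 < F r := by
  rcases hr.eq_or_lt with h | h
  · subst h
    have := hH 0
    rw [zero_mul, add_zero] at this
    rw [this]
    exact Real.exp_pos _
  · have hd : ∀ x, HasDerivAt (fun x => x * F x) (Real.exp (V x)) x := by
      intro x
      have := (hasDerivAt_id' x).fun_mul (hF x).hasDerivAt
      rwa [one_mul, hH x] at this
    have hm : StrictMono (fun x => x * F x) :=
      strictMono_of_deriv_pos fun x => by rw [(hd x).deriv]; exact Real.exp_pos _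
    have := hm h
    simp only [zero_mul] at this
    exact pos_of_mul_pos_right this h.le

/-- The radial bound propagates to the other coefficients by integration: `r F` is a primitive of
`e^V`, and `(K/2) (r F)²` is one of `K r F e^V`. All quantities compared below vanish at `r = 0`. -/
theorem curvBoundedBy_radialMetric {n : ℕ} (hF : ContDiff ℝ ∞ F) (hV : ContDiff ℝ ∞ V)
    (hH : ∀ r, F r + r * deriv F r = Real.exp (V r)) (hK : 0 ≤ K)
    (hVK : ∀ r, 0 < r → |deriv V r + r * deriv (deriv V) r| ≤ K * Real.exp (V r)) :
    CurvBoundedBy (radialMetric F : (Fin n → ℂ) → _) (7 * K) := by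
  have d0 : ∀ r, HasDerivAt F (deriv F r) r := fun r => (hF.differentiable_infty r).hasDerivAt
  have d1 : ∀ r, HasDerivAt (deriv F) (deriv (deriv F) r) r :=
    fun r => ((contDiff_deriv hF).differentiable_infty r).hasDerivAt
  have d2 : ∀ r, HasDerivAt (deriv (deriv F)) (deriv (deriv (deriv F)) r) r :=
    fun r => ((contDiff_deriv (contDiff_deriv hF)).differentiable_infty r).hasDerivAt
  have v0 : ∀ r, HasDerivAt V (deriv V r) r := fun r => (hV.differentiable_infty r).hasDerivAt
  have v1 : ∀ r, HasDerivAt (deriv V) (deriv (deriv V) r) r :=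
    fun r => ((contDiff_deriv hV).differentiable_infty r).hasDerivAt
  have hHfun : (fun r => F r + r * deriv F r) = fun r => Real.exp (V r) := funext hH
  have hH1 : ∀ r, 2 * deriv F r + r * deriv (deriv F) r = deriv V r * Real.exp (V r) := by
    intro r
    have e1 := (d0 r).fun_add ((hasDerivAt_id' r).fun_mul (d1 r))
    rw [hHfun] at e1
    have := e1.unique (v0 r).exp
    linarith
  have hH1fun : (fun r => 2 * deriv F r + r * deriv (deriv F) r)
      = fun r => deriv V r * Real.exp (V r) := funext hH1
  have hH2 : ∀ r, 3 * deriv (deriv F) r + r * deriv (deriv (deriv F)) r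
      = (deriv (deriv V) r + deriv V r ^ 2) * Real.exp (V r) := by
    intro r
    have e1 := ((d1 r).const_mul 2).fun_add ((hasDerivAt_id' r).fun_mul (d2 r))
    rw [hH1fun] at e1
    have := e1.unique ((v1 r).fun_mul (v0 r).exp)
    linarith
  have hPd : ∀ r, HasDerivAt (fun r => r * F r) (Real.exp (V r)) r := by
    intro r
    have := (hasDerivAt_id' r).fun_mul (d0 r)
    rw [one_mul, hH r] at this
    exact this
  have hpos : ∀ r, 0 ≤ r → 0 < F r := fun r hr =>
    pos_of_add_mul_deriv_eq_exp hF.differentiable_infty hH hr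
  have hP2 : ∀ r, HasDerivAt (fun r => K / 2 * (r * F r) ^ 2)
      (K * (r * F r) * Real.exp (V r)) r := by
    intro r
    refine (((hPd r).fun_pow 2).const_mul (K / 2)).congr_deriv ?_
    norm_num
    ring
  -- The derivative of `r V'` is `V' + r V''`, which `hVK` bounds by the derivative of `K r F`.
  have hxi : ∀ r, 0 ≤ r → |r * deriv V r| ≤ K * (r * F r) := by
    intro r hr
    refine abs_le_of_abs_deriv_le (f := fun r => r * deriv V r) (g := fun r => K * (r * F r))
      (f' := fun r => deriv V r + r * deriv (deriv V) r) (g' := fun r => K * Real.exp (V r))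
      (fun x => ?_) (fun x => (hPd x).const_mul K) (by simp) (by simp) hVK hr
    simpa using (hasDerivAt_id' x).fun_mul (v1 x)
  -- The derivative of `r² F'` is `r V' e^V`, to which `hxi` applies.
  have hAr : ∀ r, 0 ≤ r → |r ^ 2 * deriv F r| ≤ K / 2 * (r * F r) ^ 2 := by
    intro r hr
    refine abs_le_of_abs_deriv_le (f := fun r => r ^ 2 * deriv F r)
      (g := fun r => K / 2 * (r * F r) ^ 2) (f' := fun r => r * deriv V r * Real.exp (V r))
      (fun x => ?_) hP2 (by simp) (by simp) (fun x hx => ?_) hr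
    · refine ((hasDerivAt_pow 2 x).fun_mul (d1 x)).congr_deriv ?_
      norm_num
      linear_combination x * hH1 x
    · rw [abs_mul, Real.abs_exp]
      exact mul_le_mul_of_nonneg_right (hxi x hx.le) (Real.exp_pos _).le
  -- Differentiating and using `e^V = F + r F'`, everything cancels except `-r F (V' + r V'')`.
  have hBr : ∀ r, 0 ≤ r → |r ^ 2 * (deriv F r - F r * deriv V r)| ≤ K / 2 * (r * F r) ^ 2 := by
    intro r hr
    refine abs_le_of_abs_deriv_le (f := fun r => r ^ 2 * (deriv F r - F r * deriv V r))
      (g := fun r => K / 2 * (r * F r) ^ 2)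
      (f' := fun r => -(r * F r) * (deriv V r + r * deriv (deriv V) r))
      (fun x => ?_) hP2 (by simp) (by simp) (fun x hx => ?_) hr
    · refine ((hasDerivAt_pow 2 x).fun_mul ((d1 x).fun_sub ((d0 x).fun_mul (v1 x)))).congr_deriv ?_
      have e1 := hH1 x
      rw [← hH x] at e1
      norm_num
      linear_combination x * e1
    · have hxF : 0 ≤ x * F x := mul_nonneg hx.le (hpos x hx.le).le
      rw [abs_mul, abs_neg, abs_of_nonneg hxF]
      calc x * F x * |deriv V x + x * deriv (deriv V) x|
          ≤ x * F x * (K * Real.exp (V x)) := mul_le_mul_of_nonneg_left (hVK x hx) hxF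
        _ = _ := by ring
  have hA' : ∀ r, 0 < r → |deriv F r| ≤ K * F r ^ 2 := by
    intro r hr
    have e := hAr r hr.le
    rw [abs_mul, abs_of_pos (pow_pos hr 2), mul_pow] at e
    have e2 : r ^ 2 * |deriv F r| ≤ r ^ 2 * (K / 2 * F r ^ 2) := by linarith
    have e3 := le_of_mul_le_mul_left e2 (pow_pos hr 2)
    have : 0 ≤ K * F r ^ 2 := by positivity
    linarith
  -- Dividing by `r²` was possible only for `r > 0`; the origin follows by continuity.
  have hA : ∀ r, 0 ≤ r → |deriv F r| ≤ K * F r ^ 2 := by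
    intro r hr
    rcases hr.eq_or_lt with h | h
    · subst h
      have c1 : ContinuousWithinAt (fun r => |deriv F r|) (Set.Ioi 0) 0 :=
        (contDiff_deriv hF).continuous.abs.continuousWithinAt
      have c2 : ContinuousWithinAt (fun r => K * F r ^ 2) (Set.Ioi 0) 0 :=
        (continuous_const.mul (hF.continuous.pow 2)).continuousWithinAt
      exact le_of_tendsto_of_tendsto c1 c2 (eventually_nhdsWithin_of_forall hA')
    · exact hA' r h
  intro z X Y Z W
  have hz := sqNorm_nonneg z
  refine (sum_curv_radialMetric_bound hF rfl rfl rfl rfl rfl (hH _) (hpos _ hz) (Real.exp_pos _) hK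
    (hA _ hz) (fun hr => ?_) (fun hr => ?_) X Y Z W).trans (le_of_eq (by ring))
  · generalize sqNorm z = r at hz hr
    have hf := hpos r hz
    -- The mixed coefficient is a multiple of `F' - F V'`, the quantity controlled by `hBr`.
    have e : (deriv F r ^ 2 / F r - deriv (deriv F) r - deriv F r / r) * r
        = Real.exp (V r) * (deriv F r - F r * deriv V r) / F r := by
      have h0 := hH r
      have h1 := hH1 r
      field_simp
      linear_combination (deriv F r) * h0 - F r * h1
    have e2 := hBr r hz
    rw [abs_mul, abs_of_pos (pow_pos hr 2), mul_pow] at e2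
    have e3 : r ^ 2 * |deriv F r - F r * deriv V r| ≤ r ^ 2 * (K / 2 * F r ^ 2) := by linarith
    have e4 := le_of_mul_le_mul_left e3 (pow_pos hr 2)
    have e5 : |deriv F r - F r * deriv V r| ≤ K * F r ^ 2 := by
      have : 0 ≤ K * F r ^ 2 := by positivity
      linarith
    rw [← abs_of_pos hr, ← abs_mul, abs_of_pos hr, e, abs_div, abs_mul, Real.abs_exp,
      abs_of_pos hf, div_le_iff₀ hf]
    calc Real.exp (V r) * |deriv F r - F r * deriv V r|
        ≤ Real.exp (V r) * (K * F r ^ 2) := by gcongr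
      _ = _ := by ring
  · generalize sqNorm z = r at hz hr
    have hf := hpos r hz
    have hE := Real.exp_pos (V r)
    have h0 := hH r
    have h1 := hH1 r
    have h2 := hH2 r
    -- The radial coefficient collapses to the quantity in `hVK`. With the derivatives as free
    -- variables, the relations `h0`, `h1`, `h2` eliminate `F'`, `V'`, `V''`, and an identity of
    -- rational functions remains.
    have e : (-deriv (deriv (deriv F)) r + (4 * deriv F r * deriv (deriv F) r
          + r * deriv (deriv F) r ^ 2) / F r
        - deriv F r * (2 * deriv F r + r * deriv (deriv F) r) ^ 2 / (F r * Real.exp (V r))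
        + 4 * (deriv F r ^ 2 / F r - deriv (deriv F) r) / r - 2 * deriv F r / r ^ 2) * r ^ 2
        = -(Real.exp (V r) * (deriv V r + r * deriv (deriv V) r)) := by
      generalize Real.exp (V r) = E at *
      generalize deriv (deriv (deriv F)) r = f3 at *
      generalize deriv (deriv F) r = f2 at *
      generalize deriv F r = f1 at *
      generalize F r = f at *
      generalize deriv (deriv V) r = w2 at *
      generalize deriv V r = w1 at *
      have hEne := hE.ne'
      have hfne := hf.ne'
      have hrne := hr.ne'
      have hw1 : w1 = (2 * f1 + r * f2) / E := by field_simp; linarith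
      have hw2 : w2 = (3 * f2 + r * f3) / E - w1 ^ 2 := by field_simp; linarith
      rw [hw2, hw1]
      have hf1 : f1 = (E - f) / r := by field_simp; linarith
      rw [hf1]
      field_simp
      ring
    rw [← abs_of_pos (pow_pos hr 2), ← abs_mul, abs_of_pos (pow_pos hr 2), e, abs_neg, abs_mul,
      Real.abs_exp]
    calc Real.exp (V r) * |deriv V r + r * deriv (deriv V) r|
        ≤ Real.exp (V r) * (K * Real.exp (V r)) :=
          mul_le_mul_of_nonneg_left (hVK r hr) hE.le
      _ = _ := by ring

end RadialODE

/-! ### Radial averages -/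

section Average

open MeasureTheory

/-- The weight `s ^ m` closes the family under differentiation in `r`, which makes the induction for
smoothness possible, including at `r = 0`. -/
lemma hasDerivAt_integral_pow_mul_comp {H : ℝ → ℝ} (hH : ContDiff ℝ ∞ H) (m : ℕ) (r : ℝ) :
    HasDerivAt (fun r => ∫ s in (0 : ℝ)..1, s ^ m * H (r * s))
      (∫ s in (0 : ℝ)..1, s ^ (m + 1) * deriv H (r * s)) r := by
  have hcH := hH.continuous
  have hcH' := (contDiff_deriv hH).continuous
  obtain ⟨C, hC⟩ := (isCompact_Icc (a := -(|r| + 1)) (b := |r| + 1)).exists_bound_of_continuousOn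
    hcH'.continuousOn
  refine (intervalIntegral.hasDerivAt_integral_of_dominated_loc_of_deriv_le
    (F := fun r s => s ^ m * H (r * s)) (F' := fun r s => s ^ (m + 1) * deriv H (r * s))
    (bound := fun _ => C) (Metric.ball_mem_nhds r one_pos) (Filter.Eventually.of_forall fun x =>
      ?_) ?_ ?_ (Filter.Eventually.of_forall fun s hs x hx => ?_) (by simp)
      (Filter.Eventually.of_forall fun s hs x hx => ?_)).2
  · exact (by fun_prop : Continuous fun s => s ^ m * H (x * s)).aestronglyMeasurable
  · exact (by fun_prop : Continuous fun s => s ^ m * H (r * s)).intervalIntegrable _ _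
  · exact (by fun_prop : Continuous fun s => s ^ (m + 1) * deriv H (r * s)).aestronglyMeasurable
  · rw [Set.uIoc_of_le zero_le_one] at hs
    have hx1 : |x| ≤ |r| + 1 := by
      rw [Metric.mem_ball, Real.dist_eq] at hx
      have := abs_sub_abs_le_abs_sub x r
      linarith
    have hxs : |x * s| ≤ |r| + 1 := by
      rw [abs_mul, abs_of_pos hs.1]
      nlinarith [abs_nonneg x, hs.2, hs.1]
    have h1 := hC (x * s) ⟨(abs_le.mp hxs).1, (abs_le.mp hxs).2⟩
    have h2 : |s ^ (m + 1)| ≤ 1 := by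
      rw [abs_of_nonneg (pow_nonneg hs.1.le _)]
      exact pow_le_one₀ hs.1.le hs.2
    rw [norm_mul, Real.norm_eq_abs (s ^ (m + 1))]
    calc |s ^ (m + 1)| * ‖deriv H (x * s)‖ ≤ 1 * ‖deriv H (x * s)‖ := by gcongr
      _ ≤ C := by rw [one_mul]; exact h1
  · have h1 : HasDerivAt (fun x : ℝ => x * s) s x := by
      simpa using (hasDerivAt_id' x).mul_const s
    have h2 := ((hH.differentiable_infty (x * s)).hasDerivAt.comp x h1).const_mul (s ^ m)
    refine h2.congr_deriv ?_
    ring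

lemma contDiff_integral_pow_mul_comp (N : ℕ) : ∀ {H : ℝ → ℝ}, ContDiff ℝ ∞ H → ∀ m : ℕ,
    ContDiff ℝ N (fun r => ∫ s in (0 : ℝ)..1, s ^ m * H (r * s)) := by
  induction N with
  | zero =>
    intro H hH m
    refine contDiff_zero.mpr (continuous_iff_continuousAt.mpr fun r =>
      (hasDerivAt_integral_pow_mul_comp hH m r).continuousAt)
  | succ N ih =>
    intro H hH m
    have hd : deriv (fun r => ∫ s in (0 : ℝ)..1, s ^ m * H (r * s))
        = fun r => ∫ s in (0 : ℝ)..1, s ^ (m + 1) * deriv H (r * s) :=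
      funext fun r => (hasDerivAt_integral_pow_mul_comp hH m r).deriv
    rw [Nat.cast_succ, contDiff_succ_iff_deriv]
    refine ⟨fun r => (hasDerivAt_integral_pow_mul_comp hH m r).differentiableAt, by simp, ?_⟩
    rw [hd]
    exact ih (contDiff_deriv hH) (m + 1)

/-- The average `(1/r) ∫₀ʳ H`, written so that it makes sense for `r = 0`. -/
noncomputable def average (H : ℝ → ℝ) (r : ℝ) : ℝ := ∫ s in (0 : ℝ)..1, H (r * s)

lemma contDiff_average {H : ℝ → ℝ} (hH : ContDiff ℝ ∞ H) : ContDiff ℝ ∞ (average H) := by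
  rw [contDiff_infty]
  intro N
  have h := contDiff_integral_pow_mul_comp N hH 0
  simp only [pow_zero, one_mul] at h
  exact h

lemma mul_average (H : ℝ → ℝ) (r : ℝ) : r * average H r = ∫ s in (0 : ℝ)..r, H s := by
  rw [average, intervalIntegral.mul_integral_comp_mul_left, mul_zero, mul_one]

lemma average_add_mul_deriv {H : ℝ → ℝ} (hH : ContDiff ℝ ∞ H) (r : ℝ) :
    average H r + r * deriv (average H) r = H r := by
  have h1 := (hasDerivAt_id' r).fun_mul ((contDiff_average hH).differentiable_infty r).hasDerivAt
  simp only [mul_average] at h1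
  have h2 := intervalIntegral.integral_hasDerivAt_right (hH.continuous.intervalIntegrable 0 r)
    (hH.continuous.stronglyMeasurableAtFilter _ _) hH.continuous.continuousAt
  simpa using h1.unique h2

end Average

/-! ### Smoothing of coarsely Lipschitz functions -/

section Smoothing

open MeasureTheory

/-- A kernel of integral zero sees only the differences `ψ (t - s) - ψ t`, and its support keeps
`|s| ≤ 1`. It is applied to the derivatives of a mollifier. -/
lemma abs_convolution_le {ρ ψ : ℝ → ℝ} {L : ℝ} (hρ : Continuous ρ) (hρs : HasCompactSupport ρ)
    (hρ1 : ∀ s, 1 < |s| → ρ s = 0) (hρ0 : ∫ s, ρ s = 0) (hψ : Continuous ψ)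
    (hL : ∀ s t, |s - t| ≤ 1 → |ψ s - ψ t| ≤ L) (t : ℝ) :
    |convolution ρ ψ (ContinuousLinearMap.lsmul ℝ ℝ) volume t| ≤ L * ∫ s, |ρ s| := by
  have hρi : Integrable ρ := hρ.integrable_of_hasCompactSupport hρs
  have hi : Integrable (fun s => ρ s * ψ (t - s)) :=
    (by fun_prop : Continuous fun s => ρ s * ψ (t - s)).integrable_of_hasCompactSupport
      hρs.mul_right
  have h1 : convolution ρ ψ (ContinuousLinearMap.lsmul ℝ ℝ) volume t
      = ∫ s, ρ s * (ψ (t - s) - ψ t) := by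
    have : ∀ s, ρ s * (ψ (t - s) - ψ t) = ρ s * ψ (t - s) - ρ s * ψ t := fun s => by ring
    rw [convolution_def]
    simp only [this, ContinuousLinearMap.lsmul_apply, smul_eq_mul]
    rw [integral_sub hi (hρi.mul_const _), integral_mul_const, hρ0]
    ring
  rw [h1, ← integral_const_mul, ← Real.norm_eq_abs]
  refine norm_integral_le_of_norm_le (hρi.abs.const_mul L) (Filter.Eventually.of_forall fun s => ?_)
  rw [norm_mul, Real.norm_eq_abs, Real.norm_eq_abs, mul_comm]
  by_cases hs : 1 < |s|
  · simp [hρ1 s hs]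
  · exact mul_le_mul_of_nonneg_right (hL _ _ (by simpa using hs)) (abs_nonneg _)

/-- A continuous function with bounded oscillation on unit intervals is at bounded distance from a
smooth function with bounded first and second derivatives. -/
theorem exists_smooth_approx {ψ : ℝ → ℝ} {L : ℝ} (hψ : Continuous ψ)
    (hL : ∀ s t, |s - t| ≤ 1 → |ψ s - ψ t| ≤ L) :
    ∃ Ψ : ℝ → ℝ, ContDiff ℝ ∞ Ψ ∧ (∀ t, |Ψ t - ψ t| ≤ L) ∧
      ∃ B, ∀ t, |deriv Ψ t| ≤ B ∧ |deriv (deriv Ψ) t| ≤ B := by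
  -- Outer radius 1 matches the unit scale in `hL`; the inner radius is immaterial.
  let φ : ContDiffBump (0 : ℝ) := ⟨1 / 2, 1, by norm_num, by norm_num⟩
  let ρ : ℝ → ℝ := φ.normed volume
  have hρ : ContDiff ℝ ∞ ρ := φ.contDiff_normed
  have hρs : HasCompactSupport ρ := φ.hasCompactSupport_normed
  have hts : tsupport ρ = Metric.closedBall 0 1 := φ.tsupport_normed_eq
  have hρ' := contDiff_deriv hρ
  have hρ'' := contDiff_deriv hρ'
  have hψl : LocallyIntegrable ψ := hψ.locallyIntegrable
  have hsub1 : tsupport (deriv ρ) ⊆ Metric.closedBall 0 1 :=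
    hts ▸ closure_minimal support_deriv_subset (isClosed_tsupport ρ)
  have hsub2 : tsupport (deriv (deriv ρ)) ⊆ Metric.closedBall 0 1 :=
    (closure_minimal support_deriv_subset (isClosed_tsupport _)).trans hsub1
  have hzero : ∀ {σ : ℝ → ℝ}, tsupport σ ⊆ Metric.closedBall 0 1 → ∀ s, 1 < |s| → σ s = 0 := by
    intro σ hσ s hs
    refine image_eq_zero_of_notMem_tsupport fun h => ?_
    have := hσ h
    rw [mem_closedBall_zero_iff, Real.norm_eq_abs] at this
    linarith
  have hint : ∀ {σ : ℝ → ℝ}, ContDiff ℝ ∞ σ → HasCompactSupport σ → ∫ s, deriv σ s = 0 := by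
    intro σ hσ hσs
    exact integral_eq_zero_of_hasDerivAt_of_integrable
      (fun x => (hσ.differentiable_infty x).hasDerivAt)
      ((contDiff_deriv hσ).continuous.integrable_of_hasCompactSupport hσs.deriv)
      (hσ.continuous.integrable_of_hasCompactSupport hσs)
  have hd1 : deriv (convolution ρ ψ (ContinuousLinearMap.lsmul ℝ ℝ) volume)
      = convolution (deriv ρ) ψ (ContinuousLinearMap.lsmul ℝ ℝ) volume :=
    funext fun t => (hρs.hasDerivAt_convolution_left _ (hρ.of_le (by simp)) hψl t).deriv
  have hd2 : deriv (convolution (deriv ρ) ψ (ContinuousLinearMap.lsmul ℝ ℝ) volume)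
      = convolution (deriv (deriv ρ)) ψ (ContinuousLinearMap.lsmul ℝ ℝ) volume :=
    funext fun t => (hρs.deriv.hasDerivAt_convolution_left _ (hρ'.of_le (by simp)) hψl t).deriv
  refine ⟨convolution ρ ψ (ContinuousLinearMap.lsmul ℝ ℝ) volume,
    hρs.contDiff_convolution_left _ hρ hψl, fun t => ?_,
    max (L * ∫ s, |deriv ρ s|) (L * ∫ s, |deriv (deriv ρ) s|), fun t => ⟨?_, ?_⟩⟩
  · rw [← Real.dist_eq]
    refine φ.dist_normed_convolution_le hψ.aestronglyMeasurable fun x hx => ?_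
    rw [Metric.mem_ball, Real.dist_eq] at hx
    rw [Real.dist_eq]
    exact hL _ _ (le_of_lt hx)
  · rw [hd1]
    exact (abs_convolution_le hρ'.continuous hρs.deriv (hzero hsub1) (hint hρ hρs) hψ hL t).trans
      (le_max_left _ _)
  · rw [hd1, hd2]
    exact (abs_convolution_le hρ''.continuous hρs.deriv.deriv (hzero hsub2)
      (hint hρ' hρs.deriv) hψ hL t).trans (le_max_right _ _)

/-- A smooth version of the positive part. -/
noncomputable def smoothPosPart (x : ℝ) : ℝ := x * Real.smoothTransition x

lemma contDiff_smoothPosPart : ContDiff ℝ ∞ smoothPosPart :=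
  contDiff_id.mul Real.smoothTransition.contDiff

lemma smoothPosPart_of_nonpos {x : ℝ} (hx : x ≤ 0) : smoothPosPart x = 0 := by
  simp [smoothPosPart, Real.smoothTransition.zero_of_nonpos hx]

lemma smoothPosPart_of_one_le {x : ℝ} (hx : 1 ≤ x) : smoothPosPart x = x := by
  simp [smoothPosPart, Real.smoothTransition.one_of_one_le hx]

lemma smoothPosPart_nonneg (x : ℝ) : 0 ≤ smoothPosPart x := by
  rcases le_total x 0 with h | h
  · rw [smoothPosPart_of_nonpos h]
  · exact mul_nonneg h (Real.smoothTransition.nonneg x)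

lemma smoothPosPart_le {x : ℝ} (hx : 0 ≤ x) : smoothPosPart x ≤ x :=
  mul_le_of_le_one_right hx (Real.smoothTransition.le_one x)

lemma sub_one_le_smoothPosPart (x : ℝ) : x - 1 ≤ smoothPosPart x := by
  rcases le_total x 1 with h | h
  · linarith [smoothPosPart_nonneg x]
  · rw [smoothPosPart_of_one_le h]; linarith

/-- Outside `[0, 1]` the function is `0` or the identity; on `[0, 1]` compactness gives the bound.
-/
lemma exists_bound_deriv_smoothPosPart :
    ∃ B, 0 ≤ B ∧ ∀ x, |deriv smoothPosPart x| ≤ B ∧ |deriv (deriv smoothPosPart) x| ≤ B := by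
  have h1 := contDiff_deriv contDiff_smoothPosPart
  have h2 := contDiff_deriv h1
  obtain ⟨B₁, hB₁⟩ := (isCompact_Icc (a := (0 : ℝ)) (b := 1)).exists_bound_of_continuousOn
    h1.continuous.continuousOn
  obtain ⟨B₂, hB₂⟩ := (isCompact_Icc (a := (0 : ℝ)) (b := 1)).exists_bound_of_continuousOn
    h2.continuous.continuousOn
  have hneg : ∀ x < 0, deriv smoothPosPart x = 0 := by
    intro x hx
    have : smoothPosPart =ᶠ[nhds x] fun _ => 0 := by
      filter_upwards [Iio_mem_nhds hx] with y hy using smoothPosPart_of_nonpos (le_of_lt hy)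
    rw [this.deriv_eq, deriv_const]
  have hpos : ∀ x > 1, deriv smoothPosPart x = 1 := by
    intro x hx
    have : smoothPosPart =ᶠ[nhds x] fun y => y := by
      filter_upwards [Ioi_mem_nhds hx] with y hy using smoothPosPart_of_one_le (le_of_lt hy)
    rw [this.deriv_eq, deriv_id'']
  have hneg' : ∀ x < 0, deriv (deriv smoothPosPart) x = 0 := by
    intro x hx
    have : deriv smoothPosPart =ᶠ[nhds x] fun _ => 0 := by
      filter_upwards [Iio_mem_nhds hx] with y hy using hneg y hy
    rw [this.deriv_eq, deriv_const]
  have hpos' : ∀ x > 1, deriv (deriv smoothPosPart) x = 0 := by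
    intro x hx
    have : deriv smoothPosPart =ᶠ[nhds x] fun _ => 1 := by
      filter_upwards [Ioi_mem_nhds hx] with y hy using hpos y hy
    rw [this.deriv_eq, deriv_const]
  refine ⟨max 1 (max B₁ B₂), by positivity, fun x => ?_⟩
  have hm1 : (1 : ℝ) ≤ max 1 (max B₁ B₂) := le_max_left _ _
  rcases lt_or_ge x 0 with h | h
  · rw [hneg x h, hneg' x h, abs_zero]
    exact ⟨by linarith, by linarith⟩
  rcases lt_or_ge 1 x with h' | h'
  · rw [hpos x h', hpos' x h', abs_zero, abs_one]
    exact ⟨by linarith, by linarith⟩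
  · exact ⟨(hB₁ x ⟨h, h'⟩).trans ((le_max_left _ _).trans (le_max_right _ _)),
      (hB₂ x ⟨h, h'⟩).trans ((le_max_right _ _).trans (le_max_right _ _))⟩

/-- Second derivatives of truncations `(Ψ - M)₊` are bounded independently of `M`. -/
lemma exists_bound_deriv_deriv_truncation {Ψ : ℝ → ℝ} (hΨ : ContDiff ℝ ∞ Ψ) {B : ℝ}
    (hB : ∀ t, |deriv Ψ t| ≤ B ∧ |deriv (deriv Ψ) t| ≤ B) :
    ∃ B', 0 ≤ B' ∧ ∀ M t, |deriv (deriv fun t => smoothPosPart (Ψ t - M)) t| ≤ B' := by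
  obtain ⟨A, hA0, hA⟩ := exists_bound_deriv_smoothPosPart
  have hB0 : 0 ≤ B := (abs_nonneg _).trans (hB 0).1
  -- By the chain rule the second derivative is `σ'' Ψ'² + σ' Ψ''` with `σ = smoothPosPart`; `M`
  -- only shifts the point at which `σ'` and `σ''` are evaluated.
  refine ⟨A * B ^ 2 + A * B, by positivity, fun M t => ?_⟩
  have d0 : ∀ t, HasDerivAt (fun t => Ψ t - M) (deriv Ψ t) t := fun t =>
    (hΨ.differentiable_infty t).hasDerivAt.sub_const M
  have c0 : ∀ t, HasDerivAt (fun t => smoothPosPart (Ψ t - M))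
      (deriv smoothPosPart (Ψ t - M) * deriv Ψ t) t := fun t =>
    HasDerivAt.comp (h₂ := smoothPosPart) t
      (contDiff_smoothPosPart.differentiable_infty (Ψ t - M)).hasDerivAt (d0 t)
  have c1 : ∀ t, HasDerivAt (fun t => deriv smoothPosPart (Ψ t - M))
      (deriv (deriv smoothPosPart) (Ψ t - M) * deriv Ψ t) t := fun t =>
    HasDerivAt.comp (h₂ := deriv smoothPosPart) t
      ((contDiff_deriv contDiff_smoothPosPart).differentiable_infty (Ψ t - M)).hasDerivAt (d0 t)
  have d1 : deriv (fun t => smoothPosPart (Ψ t - M))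
      = fun t => deriv smoothPosPart (Ψ t - M) * deriv Ψ t := funext fun t => (c0 t).deriv
  have d2 := ((c1 t).fun_mul ((contDiff_deriv hΨ).differentiable_infty t).hasDerivAt).deriv
  rw [d1, d2]
  refine (abs_add_le _ _).trans ?_
  rw [abs_mul, abs_mul, abs_mul, mul_assoc, ← sq]
  have e1 := hA (Ψ t - M)
  have e2 := hB t
  have := e1.1
  have := e1.2
  have := e2.1
  have := e2.2
  gcongr

end Smoothing

/-! ### Cigar profiles with a prescribed end -/

section Profile

/-- The exponent of the profile `μ (1 + (μ r)²)^(-1/2) exp (w (log r))`. -/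
noncomputable def profile (μ : ℝ) (w : ℝ → ℝ) (r : ℝ) : ℝ :=
  Real.log μ - Real.log (1 + (μ * r) ^ 2) / 2 + w (Real.log r)

variable {μ : ℝ} {w : ℝ → ℝ}

lemma contDiff_profile (hw : ContDiff ℝ ∞ w) (hw0 : ∀ t ≤ 0, w t = 0) :
    ContDiff ℝ ∞ (profile μ w) := by
  have h1 : ContDiff ℝ ∞ (fun r : ℝ => Real.log (1 + (μ * r) ^ 2)) :=
    ContDiff.log (by fun_prop) fun r => by positivity
  have h2 : ContDiff ℝ ∞ (fun r : ℝ => w (Real.log r)) := by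
    refine contDiff_iff_contDiffAt.mpr fun r => ?_
    by_cases hr : r = 0
    -- For `|r| < 1` the logarithm is nonpositive (`Real.log` depends on `|r|`, and its value at `0`
    -- is `0`), so the term vanishes near the origin.
    · have : (fun r : ℝ => w (Real.log r)) =ᶠ[nhds r] fun _ => 0 := by
        rw [hr]
        filter_upwards [Metric.ball_mem_nhds (0 : ℝ) one_pos] with x hx
        refine hw0 _ ?_
        rw [mem_ball_zero_iff, Real.norm_eq_abs] at hx
        rw [← Real.log_abs]
        exact Real.log_nonpos (abs_nonneg x) hx.le
      exact contDiffAt_const.congr_of_eventuallyEq this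
    · exact hw.contDiffAt.comp r (Real.contDiffAt_log.mpr hr)
  unfold profile
  exact (contDiff_const.sub (h1.div_const 2)).add h2

lemma exp_profile (hμ : 0 < μ) (r : ℝ) :
    Real.exp (profile μ w r) = μ / √(1 + (μ * r) ^ 2) * Real.exp (w (Real.log r)) := by
  have h : 0 < 1 + (μ * r) ^ 2 := by positivity
  rw [profile, Real.exp_add, Real.exp_sub, Real.exp_log hμ, Real.sqrt_eq_rpow,
    Real.rpow_def_of_pos h]
  ring_nf

/-- The left side is `(r V')'`, and `r V'` has the simple form `1 / (1 + (μ r)²) - 1 + w'(log r)`.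
-/
lemma deriv_profile_add_mul {r : ℝ} (hr : 0 < r) (hw : ContDiff ℝ ∞ w)
    (hw0 : ∀ t ≤ 0, w t = 0) :
    deriv (profile μ w) r + r * deriv (deriv (profile μ w)) r
      = -(2 * μ * (μ * r) / (1 + (μ * r) ^ 2) ^ 2) + deriv (deriv w) (Real.log r) / r := by
  have hV := contDiff_profile (μ := μ) hw hw0
  have hpos : ∀ x : ℝ, 0 < 1 + (μ * x) ^ 2 := fun x => by positivity
  have hq : ∀ x : ℝ, HasDerivAt (fun x : ℝ => 1 + (μ * x) ^ 2) (2 * μ * (μ * x)) x := by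
    intro x
    refine ((((hasDerivAt_id' x).const_mul μ).fun_pow 2).const_add 1).congr_deriv ?_
    norm_num
    ring
  have hd : ∀ x : ℝ, 0 < x → HasDerivAt (profile μ w)
      (-(2 * μ * (μ * x) / (1 + (μ * x) ^ 2) / 2) + deriv w (Real.log x) * x⁻¹) x := by
    intro x hx
    have h1 := ((hq x).log (hpos x).ne').div_const 2
    have h2 : HasDerivAt (fun x => w (Real.log x)) (deriv w (Real.log x) * x⁻¹) x :=
      HasDerivAt.comp (h₂ := w) x (hw.differentiable_infty _).hasDerivAt
        (Real.hasDerivAt_log hx.ne')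
    refine ((h1.const_sub (Real.log μ)).fun_add h2).congr_deriv ?_
    ring
  have heq : (fun x => x * deriv (profile μ w) x) =ᶠ[nhds r]
      fun x => (1 / (1 + (μ * x) ^ 2) - 1) + deriv w (Real.log x) := by
    filter_upwards [Ioi_mem_nhds hr] with x hx
    have hx : 0 < x := hx
    have := (hpos x).ne'
    rw [(hd x hx).deriv]
    field_simp
    ring
  have h1 : HasDerivAt (fun x => x * deriv (profile μ w) x)
      (deriv (profile μ w) r + r * deriv (deriv (profile μ w)) r) r := by
    simpa using (hasDerivAt_id' r).fun_mul
      ((contDiff_deriv hV).differentiable_infty r).hasDerivAt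
  have h2 : HasDerivAt (fun x => deriv w (Real.log x)) (deriv (deriv w) (Real.log r) * r⁻¹) r :=
    HasDerivAt.comp (h₂ := deriv w) r ((contDiff_deriv hw).differentiable_infty _).hasDerivAt
      (Real.hasDerivAt_log hr.ne')
  have h3 := (((hasDerivAt_const r (1 : ℝ)).fun_div (hq r) (hpos r).ne').sub_const 1).fun_add h2
  have h4 := h1.unique (h3.congr_of_eventuallyEq heq)
  rw [h4]
  ring

/-- The cigar contributes at most 1, whatever `μ` is. The term in `w''` lives where `log r ≥ t₁`,
hence `μ r ≥ 1`; there the cigar factor is at least `1 / (2 r)`, which gives `2 B`. Since `w ≥ 0`,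
the factor `exp w` only helps. -/
lemma abs_deriv_profile_add_mul_le {t₁ B r : ℝ} (hμ : 0 < μ) (hw : ContDiff ℝ ∞ w)
    (ht₁ : 0 ≤ t₁) (hμt : -Real.log μ ≤ t₁) (hw0 : ∀ t ≤ t₁, w t = 0) (hwpos : ∀ t, 0 ≤ w t)
    (hB : ∀ t, |deriv (deriv w) t| ≤ B) (hr : 0 < r) :
    |deriv (profile μ w) r + r * deriv (deriv (profile μ w)) r|
      ≤ (1 + 2 * B) * Real.exp (profile μ w r) := by
  rw [deriv_profile_add_mul hr hw fun t ht => hw0 t (ht.trans ht₁), exp_profile hμ]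
  have hB0 : 0 ≤ B := (abs_nonneg _).trans (hB 0)
  set x := μ * r with hx
  have hxpos : 0 < x := mul_pos hμ hr
  have hE : μ / √(1 + x ^ 2) ≤ μ / √(1 + x ^ 2) * Real.exp (w (Real.log r)) :=
    le_mul_of_one_le_right (by positivity) (Real.one_le_exp (hwpos _))
  have h1 : 2 * μ * x / (1 + x ^ 2) ^ 2 ≤ μ / √(1 + x ^ 2) := by
    have hs : √(1 + x ^ 2) ≤ 1 + x ^ 2 := by
      rw [Real.sqrt_le_left (by positivity)]
      nlinarith [sq_nonneg x, sq_nonneg (x ^ 2)]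
    calc 2 * μ * x / (1 + x ^ 2) ^ 2 ≤ μ / (1 + x ^ 2) := by
          rw [div_le_div_iff₀ (by positivity) (by positivity)]
          have : 2 * x ≤ 1 + x ^ 2 := by nlinarith [sq_nonneg (x - 1)]
          have h3 : 0 ≤ μ * (1 + x ^ 2) := by positivity
          nlinarith [mul_le_mul_of_nonneg_left this h3]
      _ ≤ μ / √(1 + x ^ 2) := by gcongr
  have h2 : |deriv (deriv w) (Real.log r) / r| ≤ 2 * B * (μ / √(1 + x ^ 2)) := by
    rcases lt_or_ge (Real.log r) t₁ with h | h
    · have e1 : ∀ t < t₁, deriv w t = 0 := by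
        intro t ht
        have : w =ᶠ[nhds t] fun _ => 0 := by
          filter_upwards [Iio_mem_nhds ht] with y hy using hw0 y (le_of_lt hy)
        rw [this.deriv_eq, deriv_const]
      have e2 : deriv (deriv w) (Real.log r) = 0 := by
        have : deriv w =ᶠ[nhds (Real.log r)] fun _ => 0 := by
          filter_upwards [Iio_mem_nhds h] with y hy using e1 y hy
        rw [this.deriv_eq, deriv_const]
      rw [e2, zero_div, abs_zero]
      positivity
    · have hx1 : 1 ≤ x := by
        rw [← Real.log_nonneg_iff hxpos, hx, Real.log_mul hμ.ne' hr.ne']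
        linarith
      have hs : √(1 + x ^ 2) ≤ 2 * x := by
        rw [Real.sqrt_le_left (by positivity)]
        nlinarith
      rw [abs_div, abs_of_pos hr]
      calc |deriv (deriv w) (Real.log r)| / r ≤ B / r := by gcongr; exact hB _
        _ = 2 * B * (μ / (2 * x)) := by rw [hx]; field_simp
        _ ≤ 2 * B * (μ / √(1 + x ^ 2)) := by gcongr
  have h3 : |-(2 * μ * x / (1 + x ^ 2) ^ 2)| = 2 * μ * x / (1 + x ^ 2) ^ 2 := by
    rw [abs_neg, abs_of_nonneg (by positivity)]
  refine (abs_add_le _ _).trans ?_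
  rw [h3]
  calc 2 * μ * x / (1 + x ^ 2) ^ 2 + |deriv (deriv w) (Real.log r) / r|
      ≤ μ / √(1 + x ^ 2) + 2 * B * (μ / √(1 + x ^ 2)) := add_le_add h1 h2
    _ = (1 + 2 * B) * (μ / √(1 + x ^ 2)) := by ring
    _ ≤ _ := by gcongr

/-- Profiles with uniformly bounded radial curvature lie arbitrarily far below, and at finite
distance from, any `h` such that `log (r h(r))` tends to infinity and has bounded oscillation on
unit intervals in the variable `log r`. -/
theorem exists_profile {h : ℝ → ℝ} (hcont : ContinuousOn h (Set.Ici 0))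
    (hpos : ∀ r, 0 ≤ r → 0 < h r) {L : ℝ}
    (hL : ∀ s t : ℝ, |s - t| ≤ 1 →
      |(s + Real.log (h (Real.exp s))) - (t + Real.log (h (Real.exp t)))| ≤ L)
    (hlim : Filter.Tendsto (fun r => r * h r) Filter.atTop Filter.atTop) :
    ∃ K, 0 ≤ K ∧ ∀ ε, 0 < ε → ∃ V : ℝ → ℝ, ContDiff ℝ ∞ V ∧
      (∀ r, 0 < r → |deriv V r + r * deriv (deriv V) r| ≤ K * Real.exp (V r)) ∧
      ∃ C, 0 < C ∧ ∀ r, 0 ≤ r → Real.exp (V r) ≤ ε * h r ∧ h r ≤ C * Real.exp (V r) := by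
  set ψ : ℝ → ℝ := fun t => t + Real.log (h (Real.exp t)) with hψ
  have hψc : Continuous ψ := by
    have h1 : Continuous fun t => h (Real.exp t) :=
      hcont.comp_continuous Real.continuous_exp fun t => (Real.exp_pos t).le
    exact continuous_id.add (h1.log fun t => (hpos _ (Real.exp_pos t).le).ne')
  have hψexp : ∀ r, 0 < r → Real.exp (ψ (Real.log r)) = r * h r := by
    intro r hr
    simp only [hψ]
    rw [Real.exp_add, Real.exp_log hr, Real.exp_log (hpos r hr.le)]
  obtain ⟨Ψ, hΨ, hΨψ, B, hB⟩ := exists_smooth_approx hψc hL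
  obtain ⟨B', hB'0, hB'⟩ := exists_bound_deriv_deriv_truncation hΨ hB
  refine ⟨1 + 2 * B', by positivity, fun ε hε => ?_⟩
  -- Beyond `R` the cylindrical end, where `r e^V ≤ 1`, lies below `ε h`.
  obtain ⟨R, hR0, hR⟩ : ∃ R, 0 ≤ R ∧ ∀ r, R ≤ r → 1 ≤ ε * (r * h r) := by
    obtain ⟨R, hR⟩ := Filter.eventually_atTop.mp (hlim.eventually_ge_atTop (1 / ε))
    refine ⟨max R 0, le_max_right _ _, fun r hr => ?_⟩
    have := hR r ((le_max_left _ _).trans hr)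
    rw [div_le_iff₀ hε] at this
    linarith
  obtain ⟨r₀, hr₀, hmin⟩ := (isCompact_Icc (a := (0 : ℝ)) (b := R)).exists_isMinOn
    ⟨0, by simpa using hR0⟩ (hcont.mono fun x hx => hx.1)
  -- The cigar never exceeds `μ`, so taking for `μ` the minimum of `ε h` on `[0, R]` keeps it below
  -- `ε h` there.
  set μ : ℝ := ε * h r₀ with hμdef
  have hμ : 0 < μ := mul_pos hε (hpos r₀ hr₀.1)
  have hμle : ∀ r, 0 ≤ r → r ≤ R → μ ≤ ε * h r := fun r h0 h1 =>
    mul_le_mul_of_nonneg_left (hmin ⟨h0, h1⟩) hε.le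
  -- Before `t₁` the term `w` must vanish: up to `0` for smoothness at the origin, up to `-log μ` so
  -- that the cigar is already comparable to a cylinder.
  set t₁ : ℝ := max 0 (-Real.log μ) with ht₁
  obtain ⟨D, hD⟩ := (isCompact_Icc (a := (0 : ℝ)) (b := Real.exp t₁)).exists_bound_of_continuousOn
    (f := fun r => r * h r) (continuousOn_id.mul (hcont.mono fun x hx => hx.1))
  -- The first entry gives `exp w ≤ ε r h` where `Ψ > M`; the second forces `Ψ ≤ M` up to `t₁`.
  set M : ℝ := max (L - Real.log ε) (Real.log (max D 1) + L) with hM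
  have hΨM : ∀ t ≤ t₁, Ψ t ≤ M := by
    intro t ht
    have h1 : Real.exp (ψ t) ≤ max D 1 := by
      have h2 := hψexp (Real.exp t) (Real.exp_pos t)
      rw [Real.log_exp] at h2
      rw [h2]
      exact (le_abs_self _).trans ((hD (Real.exp t)
        ⟨(Real.exp_pos t).le, Real.exp_le_exp.mpr ht⟩).trans (le_max_left _ _))
    have h2 : ψ t ≤ Real.log (max D 1) := by
      rwa [Real.le_log_iff_exp_le (by positivity)]
    have h3 := (abs_le.mp (hΨψ t)).2
    have h4 : Real.log (max D 1) + L ≤ M := le_max_right _ _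
    linarith
  set w : ℝ → ℝ := fun t => smoothPosPart (Ψ t - M) with hw
  have hwc : ContDiff ℝ ∞ w := contDiff_smoothPosPart.comp (hΨ.sub contDiff_const)
  have hwpos : ∀ t, 0 ≤ w t := fun t => smoothPosPart_nonneg _
  have hw0 : ∀ t ≤ t₁, w t = 0 := fun t ht =>
    smoothPosPart_of_nonpos (by linarith [hΨM t ht])
  have hV := contDiff_profile (μ := μ) hwc fun t ht => hw0 t (ht.trans (le_max_left _ _))
  have hcig1 : ∀ r, 0 ≤ r → μ / √(1 + (μ * r) ^ 2) ≤ μ := by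
    intro r hr
    refine div_le_self hμ.le ?_
    rw [Real.one_le_sqrt]
    nlinarith [sq_nonneg (μ * r)]
  have hcig2 : ∀ r, 0 ≤ r → r * (μ / √(1 + (μ * r) ^ 2)) ≤ 1 := by
    intro r hr
    rw [mul_div_assoc', div_le_one (by positivity)]
    refine Real.le_sqrt_of_sq_le ?_
    nlinarith
  refine ⟨profile μ w, hV, fun r hr => abs_deriv_profile_add_mul_le hμ hwc (le_max_left _ _)
    (le_max_right _ _) hw0 hwpos (fun t => hB' M t) hr, ?_⟩
  obtain ⟨D', hD'⟩ := (isCompact_Icc (a := (0 : ℝ)) (b := 1 / μ)).exists_bound_of_continuousOn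
    (hcont.mono fun x hx => hx.1)
  -- `C₁` serves on `[0, 1/μ]`, where the cigar is at least `μ / 2`; `C₂` serves beyond, where it is
  -- at least `1 / (2 r)`.
  set C₁ : ℝ := 2 * max D' 1 / μ with hC₁
  set C₂ : ℝ := 2 * Real.exp (L + M + 1) with hC₂
  have hC₁0 : 0 < C₁ := by positivity
  have hC₂0 : 0 < C₂ := by positivity
  refine ⟨max C₁ C₂, by positivity, fun r hr => ⟨?_, ?_⟩⟩
  · rw [exp_profile hμ]
    rcases le_or_gt (Ψ (Real.log r)) M with hle | hgt
    · have : w (Real.log r) = 0 := smoothPosPart_of_nonpos (by linarith)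
      rw [this, Real.exp_zero, mul_one]
      rcases le_total r R with h1 | h1
      · exact (hcig1 r hr).trans (hμle r hr h1)
      · rcases hr.eq_or_lt with h2 | h2
        · subst h2
          exact (hcig1 0 le_rfl).trans (hμle 0 le_rfl hR0)
        · have h3 := (hcig2 r hr).trans (hR r h1)
          have h4 : r * (μ / √(1 + (μ * r) ^ 2)) ≤ r * (ε * h r) := by linarith
          exact le_of_mul_le_mul_left h4 h2
    · have hrpos : 0 < r := by
        rcases hr.eq_or_lt with h2 | h2
        -- Since `Real.log 0 = 0 ≤ t₁`, the origin belongs to the case `Ψ ≤ M`.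
        · subst h2
          rw [Real.log_zero] at hgt
          exact absurd (hΨM 0 (le_max_left _ _)) (not_le.mpr hgt)
        · exact h2
      have h1 : w (Real.log r) ≤ Ψ (Real.log r) - M := smoothPosPart_le (by linarith)
      have h2 := (abs_le.mp (hΨψ (Real.log r))).2
      have h3 : L - Real.log ε ≤ M := le_max_left _ _
      have h4 : Real.exp (w (Real.log r)) ≤ ε * (r * h r) := by
        have e : ε * Real.exp (ψ (Real.log r)) = Real.exp (Real.log ε + ψ (Real.log r)) := by
          rw [Real.exp_add (Real.log ε), Real.exp_log hε]
        rw [← hψexp r hrpos, e, Real.exp_le_exp]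
        linarith
      have h5 : r * (μ / √(1 + (μ * r) ^ 2) * Real.exp (w (Real.log r))) ≤ r * (ε * h r) := by
        rw [← mul_assoc]
        calc r * (μ / √(1 + (μ * r) ^ 2)) * Real.exp (w (Real.log r))
            ≤ 1 * Real.exp (w (Real.log r)) := by gcongr; exact hcig2 r hr
          _ ≤ r * (ε * h r) := by linarith
      exact le_of_mul_le_mul_left h5 hrpos
  · rw [exp_profile hμ]
    have hew : 1 ≤ Real.exp (w (Real.log r)) := Real.one_le_exp (hwpos _)
    rcases le_total r (1 / μ) with h1 | h1
    · have hx1 : μ * r ≤ 1 := by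
        rw [le_div_iff₀ hμ] at h1; linarith
      have hs : √(1 + (μ * r) ^ 2) ≤ 2 := by
        rw [Real.sqrt_le_left (by norm_num)]
        have : 0 ≤ μ * r := by positivity
        nlinarith
      have h2 : h r ≤ max D' 1 :=
        (le_abs_self _).trans ((hD' r ⟨hr, h1⟩).trans (le_max_left _ _))
      calc h r ≤ max D' 1 := h2
        _ = C₁ * (μ / 2 * 1) := by rw [hC₁]; field_simp
        _ ≤ max C₁ C₂ * (μ / √(1 + (μ * r) ^ 2) * Real.exp (w (Real.log r))) := by
          gcongr
          exact le_max_left _ _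
    · have hrpos : 0 < r := lt_of_lt_of_le (by positivity) h1
      have hx1 : 1 ≤ μ * r := by
        rw [div_le_iff₀ hμ] at h1; linarith
      have hs : √(1 + (μ * r) ^ 2) ≤ 2 * (μ * r) := by
        rw [Real.sqrt_le_left (by positivity)]
        nlinarith
      have h2 := (abs_le.mp (hΨψ (Real.log r))).1
      have h3 : Ψ (Real.log r) - M - 1 ≤ w (Real.log r) := sub_one_le_smoothPosPart _
      have h4 : r * h r ≤ Real.exp (L + M + 1) * Real.exp (w (Real.log r)) := by
        rw [← hψexp r hrpos, ← Real.exp_add, Real.exp_le_exp]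
        linarith
      have h5 : r * h r ≤ r * (max C₁ C₂ * (μ / √(1 + (μ * r) ^ 2)
          * Real.exp (w (Real.log r)))) := by
        calc r * h r ≤ Real.exp (L + M + 1) * Real.exp (w (Real.log r)) := h4
          _ = r * (C₂ * (μ / (2 * (μ * r)) * Real.exp (w (Real.log r)))) := by
            rw [hC₂]; field_simp
          _ ≤ _ := by
            gcongr
            exact le_max_right _ _
      exact le_of_mul_le_mul_left h5 hrpos

end Profile

/-! ### The generating functions -/

section Generator

open MeasureTheory

variable {ξ : ℝ → ℝ} {c : ℝ}

/-- As `ξ` vanishes at `0` and has bounded derivative on `[0, R]`, `|ξ s| ≤ C s`, so the quotient is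
bounded. -/
lemma intervalIntegrable_div_self (hξ : ContDiffOn ℝ ∞ ξ (Set.Ici 0)) (h0 : ξ 0 = 0) {a b : ℝ}
    (ha : 0 ≤ a) (hb : 0 ≤ b) : IntervalIntegrable (fun s => ξ s / s) volume a b := by
  set R := max a b with hR
  have hR0 : 0 ≤ R := ha.trans (le_max_left _ _)
  have hcd : ContinuousOn (derivWithin ξ (Set.Ici 0)) (Set.Ici 0) :=
    hξ.continuousOn_derivWithin (uniqueDiffOn_Ici 0) (by simp)
  obtain ⟨C, hC⟩ := (isCompact_Icc (a := (0 : ℝ)) (b := R)).exists_bound_of_continuousOn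
    (hcd.mono fun x hx => hx.1)
  have hdiff : ∀ x ∈ Set.Icc 0 R,
      HasDerivWithinAt ξ (derivWithin ξ (Set.Ici 0) x) (Set.Icc 0 R) x := fun x hx =>
    ((hξ.differentiableOn (by simp) x hx.1).hasDerivWithinAt).mono fun y hy => hy.1
  have hlip : ∀ s ∈ Set.Icc 0 R, |ξ s| ≤ C * |s| := by
    intro s hs
    have := (convex_Icc 0 R).norm_image_sub_le_of_norm_hasDerivWithin_le hdiff hC
      (Set.left_mem_Icc.mpr hR0) hs
    simpa [h0] using this
  have hint : IntegrableOn (fun s => ξ s / s) (Set.Ioc 0 R) := by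
    refine IntegrableOn.of_bound (C := C) (by simp) ?_ ?_
    · refine ContinuousOn.aestronglyMeasurable ?_ measurableSet_Ioc
      exact (hξ.continuousOn.mono fun x hx => hx.1.le).div continuousOn_id fun x hx => hx.1.ne'
    · refine (ae_restrict_iff' measurableSet_Ioc).mpr (Filter.Eventually.of_forall fun s hs => ?_)
      rw [norm_div, Real.norm_eq_abs, Real.norm_eq_abs, div_le_iff₀ (abs_pos.mpr hs.1.ne')]
      exact hlip s ⟨hs.1.le, hs.2⟩
  have h1 : IntervalIntegrable (fun s => ξ s / s) volume 0 R :=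
    (intervalIntegrable_iff_integrableOn_Ioc_of_le hR0).mpr hint
  refine h1.mono_set ?_
  rw [Set.uIcc_of_le hR0]
  exact Set.uIcc_subset_Icc ⟨ha, le_max_left _ _⟩ ⟨hb, le_max_right _ _⟩

lemma hGen_pos (hc : 0 < c) (r : ℝ) : 0 < hGen ξ c r := mul_pos hc (Real.exp_pos _)

lemma continuousOn_hGen (hξ : ContDiffOn ℝ ∞ ξ (Set.Ici 0)) (h0 : ξ 0 = 0) :
    ContinuousOn (hGen ξ c) (Set.Ici 0) := by
  have h : ContinuousOn (fun r => ∫ s in (0 : ℝ)..r, -(ξ s / s)) (Set.Ici 0) := by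
    intro r hr
    have hr : 0 ≤ r := hr
    have hi : IntegrableOn (fun s => -(ξ s / s)) (Set.uIcc 0 (r + 1)) := by
      have := (intervalIntegrable_div_self hξ h0 le_rfl (by linarith : (0 : ℝ) ≤ r + 1)).neg
      rw [intervalIntegrable_iff_integrableOn_Icc_of_le (by linarith)] at this
      rw [Set.uIcc_of_le (by linarith)]
      exact this
    have h1 := intervalIntegral.continuousOn_primitive_interval hi r
      (by rw [Set.uIcc_of_le (by linarith)]; exact ⟨hr, by linarith⟩)
    refine h1.mono_of_mem_nhdsWithin ?_
    rw [Set.uIcc_of_le (by linarith)]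
    have : Set.Iic (r + 1) ∈ nhds r := Iic_mem_nhds (by linarith)
    filter_upwards [self_mem_nhdsWithin, mem_nhdsWithin_of_mem_nhds this] with x h1 h2
      using ⟨h1, h2⟩
  exact continuousOn_const.mul (Real.continuous_exp.comp_continuousOn h)

lemma log_hGen (hc : 0 < c) (r : ℝ) :
    Real.log (hGen ξ c r) = Real.log c + ∫ s in (0 : ℝ)..r, -(ξ s / s) := by
  rw [hGen, Real.log_mul hc.ne' (Real.exp_pos _).ne', Real.log_exp]

/-- Since `log h` is a primitive of `-ξ / s`, this turns integral conditions on `ξ` into increments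
of `log h`. It is used with `κ` equal to `α`, `β`, `0` and `1`. -/
lemma integral_sub_div_eq (hξ : ContDiffOn ℝ ∞ ξ (Set.Ici 0)) (h0 : ξ 0 = 0) (hc : 0 < c)
    (κ : ℝ) {a r : ℝ} (ha : 0 < a) (hr : 0 < r) :
    ∫ s in a..r, (κ - ξ s) / s = κ * (Real.log r - Real.log a)
      + (Real.log (hGen ξ c r) - Real.log (hGen ξ c a)) := by
  have hinv : IntervalIntegrable (fun s : ℝ => κ * s⁻¹) volume a r := by
    refine (intervalIntegral.intervalIntegrable_inv (fun x hx => ?_) continuousOn_id).const_mul κ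
    have : 0 < x := lt_of_lt_of_le (lt_min ha hr) hx.1
    exact this.ne'
  have hq : IntervalIntegrable (fun s => -(ξ s / s)) volume a r :=
    (intervalIntegrable_div_self hξ h0 ha.le hr.le).neg
  have h1 : ∀ s, (κ - ξ s) / s = κ * s⁻¹ + -(ξ s / s) := fun s => by ring
  have h2 : (∫ s in (0 : ℝ)..r, -(ξ s / s)) - ∫ s in (0 : ℝ)..a, -(ξ s / s)
      = ∫ s in a..r, -(ξ s / s) :=
    intervalIntegral.integral_interval_sub_left
      (intervalIntegrable_div_self hξ h0 le_rfl hr.le).neg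
      (intervalIntegrable_div_self hξ h0 le_rfl ha.le).neg
  simp only [h1]
  rw [intervalIntegral.integral_add hinv hq, intervalIntegral.integral_const_mul,
    integral_inv_of_pos ha hr, Real.log_div hr.ne' ha.ne', ← h2, log_hGen hc, log_hGen hc]
  ring

lemma mul_fGen (ξ : ℝ → ℝ) (c : ℝ) {r : ℝ} (hr : r ≠ 0) :
    r * fGen ξ c r = ∫ s in (0 : ℝ)..r, hGen ξ c s := by
  rw [fGen, if_neg hr]
  field_simp

/-- Only `r > 0` is treated: at `0` the two-sided derivative would involve `ξ` on the negative axis.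
The comparison of metrics does not need it there. -/
lemma fGen_add_mul_deriv (hξ : ContDiffOn ℝ ∞ ξ (Set.Ici 0)) (h0 : ξ 0 = 0) {r : ℝ}
    (hr : 0 < r) : fGen ξ c r + r * deriv (fGen ξ c) r = hGen ξ c r := by
  have hcont := continuousOn_hGen (c := c) hξ h0
  have hnhds : Set.Ici (0 : ℝ) ∈ nhds r := Ici_mem_nhds hr
  have hint : IntervalIntegrable (hGen ξ c) volume 0 r :=
    (hcont.mono (by rw [Set.uIcc_of_le hr.le]; exact fun x hx => hx.1)).intervalIntegrable
  have hmeas : StronglyMeasurableAtFilter (hGen ξ c) (nhds r) volume :=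
    ⟨Set.Ici 0, hnhds, hcont.aestronglyMeasurable measurableSet_Ici⟩
  have h1 := intervalIntegral.integral_hasDerivAt_right hint hmeas (hcont.continuousAt hnhds)
  have h2 := (hasDerivAt_inv hr.ne').fun_mul h1
  have heq : fGen ξ c =ᶠ[nhds r] fun x => x⁻¹ * ∫ s in (0 : ℝ)..x, hGen ξ c s := by
    filter_upwards [Ioi_mem_nhds hr] with x hx
    have hx : 0 < x := hx
    rw [fGen, if_neg hx.ne', one_div]
  rw [(h2.congr_of_eventuallyEq heq).deriv, fGen, if_neg hr.ne']
  field_simp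
  ring

/-- The two properties of `h` that the construction uses, from the first condition. -/
lemma CondC1.oscillation (hC : CondC1 ξ) (hξ : ContDiffOn ℝ ∞ ξ (Set.Ici 0)) (h0 : ξ 0 = 0)
    (hc : 0 < c) :
    (∃ L, ∀ s t : ℝ, s < t → t - s ≤ 1 →
      |Real.log (hGen ξ c (Real.exp t)) - Real.log (hGen ξ c (Real.exp s))| ≤ L) ∧
    Filter.Tendsto (fun r => Real.log r + Real.log (hGen ξ c r)) Filter.atTop Filter.atTop := by
  obtain ⟨α, β, γ, hα, hαβ, hβ, H⟩ := hC
  have key : ∀ a r, 0 < a → a < r →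
      α * (Real.log r - Real.log a) + (Real.log (hGen ξ c r) - Real.log (hGen ξ c a)) ≤ γ ∧
      -(β * (Real.log r - Real.log a) + (Real.log (hGen ξ c r) - Real.log (hGen ξ c a))) ≤ γ := by
    intro a r ha har
    have h1 := H a r ha har
    have e : ∀ s, (ξ s - β) / s = -((β - ξ s) / s) := fun s => by ring
    simp only [e] at h1
    rw [intervalIntegral.integral_neg, integral_sub_div_eq hξ h0 hc α ha (ha.trans har),
      integral_sub_div_eq hξ h0 hc β ha (ha.trans har)] at h1
    exact h1
  -- The summand 1 absorbs `β (t - s)`; the term in `α` is nonnegative and is dropped.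
  refine ⟨⟨|γ| + 1, fun s t hst hst1 => ?_⟩, ?_⟩
  · have h1 := key _ _ (Real.exp_pos s) (Real.exp_lt_exp.mpr hst)
    rw [Real.log_exp, Real.log_exp] at h1
    have h2 := le_abs_self γ
    have h3 : 0 ≤ α * (t - s) := mul_nonneg hα (by linarith)
    have h4 : β * (t - s) ≤ 1 := by nlinarith
    exact abs_le.mpr ⟨by linarith [h1.2], by linarith [h1.1]⟩
  -- The `β` inequality with `a = 1` gives `log (r h(r)) ≥ (1 - β) log r + const`, and `β < 1`.
  · have h1 : Filter.Tendsto (fun r => (1 - β) * Real.log r + (Real.log (hGen ξ c 1) - γ))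
        Filter.atTop Filter.atTop :=
      Filter.tendsto_atTop_add_const_right _ _
        (Real.tendsto_log_atTop.const_mul_atTop (by linarith))
    refine Filter.tendsto_atTop_mono' _ ?_ h1
    filter_upwards [Filter.eventually_gt_atTop 1] with r hr
    have h2 := (key 1 r one_pos hr).2
    rw [Real.log_one, sub_zero] at h2
    linarith

/-- The two properties of `h` that the construction uses, from the second condition. -/
lemma CondC2.oscillation (hC : CondC2 ξ) (hξ : ContDiffOn ℝ ∞ ξ (Set.Ici 0)) (h0 : ξ 0 = 0)
    (hc : 0 < c) :
    (∃ L, ∀ s t : ℝ, s < t → t - s ≤ 1 →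
      |Real.log (hGen ξ c (Real.exp t)) - Real.log (hGen ξ c (Real.exp s))| ≤ L) ∧
    Filter.Tendsto (fun r => Real.log r + Real.log (hGen ξ c r)) Filter.atTop Filter.atTop := by
  obtain ⟨h1, h2, -⟩ := hC
  constructor
  -- Convergence at infinity and continuity make `ξ` bounded, and `ds / s` has mass `t - s ≤ 1` on
  -- `[e^s, e^t]`.
  · obtain ⟨R, hR⟩ := Filter.eventually_atTop.mp (h1.norm.eventually_le_const
      (by simp : ‖(1 : ℝ)‖ < 2))
    obtain ⟨B, hB⟩ := (isCompact_Icc (a := (0 : ℝ)) (b := R)).exists_bound_of_continuousOn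
      (hξ.continuousOn.mono fun x hx => hx.1)
    have hbd : ∀ s, 0 ≤ s → |ξ s| ≤ max B 2 := by
      intro s hs
      rcases le_total s R with h | h
      · exact (hB s ⟨hs, h⟩).trans (le_max_left _ _)
      · exact (hR s h).trans (le_max_right _ _)
    refine ⟨max B 2, fun s t hst hst1 => ?_⟩
    have hlt := Real.exp_lt_exp.mpr hst
    have e := integral_sub_div_eq hξ h0 hc 0 (Real.exp_pos s) (Real.exp_pos t)
    rw [zero_mul, zero_add] at e
    rw [← e, ← Real.norm_eq_abs]
    have hinv : IntervalIntegrable (fun s : ℝ => max B 2 * s⁻¹) volume (Real.exp s)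
        (Real.exp t) := by
      refine (intervalIntegral.intervalIntegrable_inv (fun x hx => ?_) continuousOn_id).const_mul _
      rw [Set.uIcc_of_le hlt.le] at hx
      exact ((Real.exp_pos s).trans_le hx.1).ne'
    have h3 : ‖∫ x in Real.exp s..Real.exp t, (0 - ξ x) / x‖
        ≤ ∫ x in Real.exp s..Real.exp t, max B 2 * x⁻¹ := by
      refine intervalIntegral.norm_integral_le_of_norm_le hlt.le
        (Filter.Eventually.of_forall fun x hx => ?_) hinv
      have hx0 : 0 < x := (Real.exp_pos s).trans hx.1
      rw [norm_div, zero_sub, norm_neg, Real.norm_eq_abs, Real.norm_eq_abs, abs_of_pos hx0,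
        div_eq_mul_inv]
      gcongr
      exact hbd x hx0.le
    refine h3.trans ?_
    rw [intervalIntegral.integral_const_mul, integral_inv_of_pos (Real.exp_pos s) (Real.exp_pos t),
      Real.log_div (Real.exp_pos t).ne' (Real.exp_pos s).ne', Real.log_exp, Real.log_exp]
    exact mul_le_of_le_one_right (by positivity) hst1
  -- The divergent integral is `log (r h(r))` up to the constant `log h(1)`.
  · have h3 := Filter.tendsto_atTop_add_const_right _ (Real.log (hGen ξ c 1)) h2
    refine h3.congr' ?_
    filter_upwards [Filter.eventually_gt_atTop 0] with r hr
    rw [integral_sub_div_eq hξ h0 hc 1 one_pos hr, Real.log_one]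
    ring

/-- Two radial metrics are ordered if the generating functions are. -/
lemma quad_radialMetric_le {n : ℕ} {F G : ℝ → ℝ} {A : ℝ} {z : Fin n → ℂ}
    (hFG : F (sqNorm z) ≤ A * G (sqNorm z))
    (hH : 0 < sqNorm z → F (sqNorm z) + sqNorm z * deriv F (sqNorm z)
      ≤ A * (G (sqNorm z) + sqNorm z * deriv G (sqNorm z))) (X : Fin n → ℂ) :
    quad (radialMetric F) z X ≤ A * quad (radialMetric G) z X := by
  by_cases hz : sqNorm z = 0
  -- At the origin the derivative of the generating function is multiplied by `0`, so its value is
  -- irrelevant.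
  · have hip : ip X z = 0 := by simp [sqNorm_eq_zero hz, ip]
    rw [quad_radialMetric, quad_radialMetric, hip]
    have := mul_le_mul_of_nonneg_right hFG (sqNorm_nonneg X)
    simp only [norm_zero]
    nlinarith
  · have hr : 0 < sqNorm z := lt_of_le_of_ne (sqNorm_nonneg z) (Ne.symm hz)
    rw [quad_radialMetric_eq_perp F hz, quad_radialMetric_eq_perp G hz]
    have h1 := mul_le_mul_of_nonneg_right hFG (sqNorm_nonneg (perp z X))
    have h2 := mul_le_mul_of_nonneg_right (hH hr)
      (by positivity : 0 ≤ ‖ip X z‖ ^ 2 / sqNorm z)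
    linarith

lemma fGen_zero (ξ : ℝ → ℝ) (c : ℝ) : fGen ξ c 0 = hGen ξ c 0 := by
  simp [fGen, hGen]

lemma average_zero (H : ℝ → ℝ) : average H 0 = H 0 := by
  simp [average]

/-- The theorem under the common consequence of the two conditions. -/
theorem exists_metric_of_oscillation {n : ℕ} {ξ : ℝ → ℝ} {c : ℝ} (hc : 0 < c)
    (hξ : ContDiffOn ℝ ∞ ξ (Set.Ici 0)) (h0 : ξ 0 = 0)
    (hosc : ∃ L, ∀ s t : ℝ, s < t → t - s ≤ 1 →
      |Real.log (hGen ξ c (Real.exp t)) - Real.log (hGen ξ c (Real.exp s))| ≤ L)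
    (hlim : Filter.Tendsto (fun r => Real.log r + Real.log (hGen ξ c r)) Filter.atTop
      Filter.atTop) :
    ∃ K : ℝ, ∀ ε : ℝ, 0 < ε →
      ∃ g' : (Fin n → ℂ) → Matrix (Fin n) (Fin n) ℂ,
        IsKahlerMetric g' ∧ IsUnitaryInvariant g' ∧ CurvBoundedBy g' K ∧
        ∃ C : ℝ, 0 < C ∧ ∀ z X : Fin n → ℂ,
          (1 / ε) * quad g' z X ≤ quad (radialMetric (fGen ξ c)) z X ∧
          quad (radialMetric (fGen ξ c)) z X ≤ C * quad g' z X := by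
  obtain ⟨L, hL⟩ := hosc
  have hcont := continuousOn_hGen (c := c) hξ h0
  have hL' : ∀ s t : ℝ, |s - t| ≤ 1 → |(s + Real.log (hGen ξ c (Real.exp s)))
      - (t + Real.log (hGen ξ c (Real.exp t)))| ≤ |L| + 1 := by
    intro s t hst
    have h1 : |Real.log (hGen ξ c (Real.exp s)) - Real.log (hGen ξ c (Real.exp t))| ≤ |L| := by
      rcases lt_trichotomy s t with h | h | h
      · rw [abs_sub_comm]
        exact (hL s t h (by linarith [(abs_le.mp hst).1])).trans (le_abs_self L)
      · rw [h, sub_self, abs_zero]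
        exact abs_nonneg L
      · exact (hL t s h (by linarith [(abs_le.mp hst).2])).trans (le_abs_self L)
    rw [add_sub_add_comm]
    exact (abs_add_le _ _).trans (by linarith)
  have hlim' : Filter.Tendsto (fun r => r * hGen ξ c r) Filter.atTop Filter.atTop := by
    refine (Real.tendsto_exp_atTop.comp hlim).congr' ?_
    filter_upwards [Filter.eventually_gt_atTop 0] with r hr
    rw [Function.comp_apply, Real.exp_add, Real.exp_log hr, Real.exp_log (hGen_pos hc r)]
  -- `K` is obtained before `ε` is introduced, which is the uniformity claimed in the theorem.
  obtain ⟨K, hK, H⟩ := exists_profile hcont (fun r _ => hGen_pos hc r) hL' hlim'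
  refine ⟨7 * K, fun ε hε => ?_⟩
  obtain ⟨V, hV, hVK, C, hC, hVh⟩ := H ε hε
  have hexp : ContDiff ℝ ∞ fun r => Real.exp (V r) := hV.exp
  set F : ℝ → ℝ := average fun r => Real.exp (V r) with hF
  have hFc : ContDiff ℝ ∞ F := contDiff_average hexp
  have hFH : ∀ r, F r + r * deriv F r = Real.exp (V r) := average_add_mul_deriv hexp
  have hFpos : ∀ r, 0 ≤ r → 0 < F r := fun r hr =>
    pos_of_add_mul_deriv_eq_exp hFc.differentiable_infty hFH hr
  have hint : ∀ r, 0 ≤ r → IntervalIntegrable (hGen ξ c) volume 0 r := fun r hr =>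
    (hcont.mono (by rw [Set.uIcc_of_le hr]; exact fun x hx => hx.1)).intervalIntegrable
  -- Pointwise inequalities between the radial eigenvalues pass to their averages, the tangential
  -- eigenvalues.
  have hle₁ : ∀ r, 0 ≤ r → F r ≤ ε * fGen ξ c r := by
    intro r hr
    rcases hr.eq_or_lt with h | h
    · subst h
      rw [hF, average_zero, fGen_zero]
      exact (hVh 0 le_rfl).1
    · have h1 : r * F r ≤ r * (ε * fGen ξ c r) := by
        rw [hF, mul_average, mul_left_comm, mul_fGen ξ c h.ne',
          ← intervalIntegral.integral_const_mul]
        exact intervalIntegral.integral_mono_on hr (hexp.continuous.intervalIntegrable _ _)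
          ((hint r hr).const_mul ε) fun x hx => (hVh x hx.1).1
      exact le_of_mul_le_mul_left h1 h
  have hle₂ : ∀ r, 0 ≤ r → fGen ξ c r ≤ C * F r := by
    intro r hr
    rcases hr.eq_or_lt with h | h
    · subst h
      rw [hF, average_zero, fGen_zero]
      exact (hVh 0 le_rfl).2
    · have h1 : r * fGen ξ c r ≤ r * (C * F r) := by
        rw [hF, mul_left_comm, mul_average, mul_fGen ξ c h.ne',
          ← intervalIntegral.integral_const_mul]
        exact intervalIntegral.integral_mono_on hr (hint r hr)
          ((hexp.continuous.intervalIntegrable _ _).const_mul C) fun x hx => (hVh x hx.1).2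
      exact le_of_mul_le_mul_left h1 h
  refine ⟨radialMetric F, isKahlerMetric_radialMetric hFc hFpos fun r _ => ?_,
    isUnitaryInvariant_radialMetric F, curvBoundedBy_radialMetric hFc hV hFH hK hVK, C, hC,
    fun z X => ⟨?_, ?_⟩⟩
  · rw [hFH]
    exact Real.exp_pos _
  · rw [one_div, inv_mul_le_iff₀ hε]
    refine quad_radialMetric_le (hle₁ _ (sqNorm_nonneg z)) (fun hr => ?_) X
    rw [hFH, fGen_add_mul_deriv hξ h0 hr]
    exact (hVh _ hr.le).1
  · refine quad_radialMetric_le (hle₂ _ (sqNorm_nonneg z)) (fun hr => ?_) X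
    rw [hFH, fGen_add_mul_deriv hξ h0 hr]
    exact (hVh _ hr.le).2

end Generator

end UnKahler

/-! ### The main theorem. -/

theorem mainTheorem6 (n : ℕ) (hn : 0 < n)
    (g : (Fin n → ℂ) → Matrix (Fin n) (Fin n) ℂ)
    (hg : UnKahler.IsKahlerMetric g) (hU : UnKahler.IsUnitaryInvariant g)
    (hK : ∃ K₀ : ℝ, UnKahler.CurvBoundedBy g K₀)
    (ξ : ℝ → ℝ) (hξ : UnKahler.IsGeneratedBy g ξ)
    (hc : UnKahler.CondC1 ξ ∨ UnKahler.CondC2 ξ) :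
    ∃ K : ℝ, ∀ ε : ℝ, 0 < ε →
      ∃ g' : (Fin n → ℂ) → Matrix (Fin n) (Fin n) ℂ,
        UnKahler.IsKahlerMetric g' ∧ UnKahler.IsUnitaryInvariant g' ∧
        UnKahler.CurvBoundedBy g' K ∧
        ∃ C : ℝ, 0 < C ∧ ∀ z X : Fin n → ℂ,
          (1 / ε) * UnKahler.quad g' z X ≤ UnKahler.quad g z X ∧
          UnKahler.quad g z X ≤ C * UnKahler.quad g' z X := by
  obtain ⟨hξs, hξ0, c, hc0, hgen⟩ := hξ
  have hgeq : g = UnKahler.radialMetric (UnKahler.fGen ξ c) := by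
    funext z i j
    exact hgen z i j
  rw [hgeq]
  have hosc := hc.elim (fun h => h.oscillation hξs hξ0 hc0) (fun h => h.oscillation hξs hξ0 hc0)
  exact UnKahler.exists_metric_of_oscillation hc0 hξs hξ0 hosc.1 hosc.2
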